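/- Let $V$ be an $n$-dimensional complex vector space. A *reflection* is an element $t\in GL(V)$ with $\dim\{v : t(v)=v\}=n-1$. Let $W\subseteq GL(V)$ be an irreducible complex reflection group of rank $n$. That is, $W$ is a finite subgroup generated by reflections, and it cannot be expressed as a direct product $W_1\times W_2$ of reflection groups acting on $V=V_1\oplus V_2$ unless $V_1=0$ or $V_2=0$. If $n=1$, assume moreover that $W$ is nontrivial. Let $W$ act on $\wedge(V\oplus V^*)$, bigraded with $V$ in bidegree $(1,0)$ and $V^*$ in bidegree $(0,1)$. Let $$DR_W=\wedge(V\oplus V^*)\big/\big\langle \wedge(V\oplus V^*)^W_+\big\rangle$$ be the quotient by the two-sided ideal generated by the $W$-invariant elements with vanishing constant term, and let $(DR_W)_{i,j}$ be the image in $DR_W$ of the bidegree $(i,j)$ part of $\wedge(V\oplus V^*)$. Let $\Pi(n)_{\ge 0}$ be the set of $n$-step lattice paths $\sigma=(s_1,\dots,s_n)$ in $\mathbb{Z}^2$ which start at the origin, never sink below the $x$-axis, and consist of up-steps $(1,1)$, down-steps $(1,-1)$ and horizontal steps $(1,0)$, each horizontal step being decorated with a $\theta$ or a $\xi$. Let $\deg_\theta(\sigma)$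 (respectively $\deg_\xi(\sigma)$) be the number of down-steps of $\sigma$ plus the number of its $\theta$-decorated (respectively $\xi$-decorated) horizontal steps. Then $DR_W=\bigoplus_{i,j\ge 0}(DR_W)_{i,j}$ with finite-dimensional pieces, and the bigraded Hilbert series of $DR_W$ is $$\mathrm{Hilb}(DR_W;q,t):=\sum_{i,j\ge 0}\dim (DR_W)_{i,j}\,q^i t^j=\sum_{\sigma\in\Pi(n)_{\ge 0}}q^{\deg_\theta(\sigma)}\,t^{\deg_\xi(\sigma)} .$$ -/

import Mathlib

open scoped BigOperators

noncomputable section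

namespace FermionicCoinvariants

/-! ### Complex reflection groups -/

section Reflections

variable {V : Type*} [AddCommGroup V] [Module ℂ V]

/-- The fixed space `V^t = {v | t v = v}`. -/
def fixedSpace (t : V ≃ₗ[ℂ] V) : Submodule ℂ V :=
  LinearMap.eqLocus (t : V →ₗ[ℂ] V) LinearMap.id

/-- `t` is a reflection if `dim V^t = dim V - 1`. -/
def IsReflection (t : V ≃ₗ[ℂ] V) : Prop :=
  Module.finrank ℂ (fixedSpace t) + 1 = Module.finrank ℂ V

/-- A complex reflection group: a finite subgroup of `GL(V)` generated by reflections. -/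
def IsComplexReflectionGroup (W : Subgroup (V ≃ₗ[ℂ] V)) : Prop :=
  Finite W ∧ Subgroup.closure {t : V ≃ₗ[ℂ] V | t ∈ W ∧ IsReflection t} = W

/-- `W` is the direct product of `W₁ ≤ GL(V₁)` and `W₂ ≤ GL(V₂)`, acting on `V = V₁ ⊕ V₂`
componentwise (used for complementary subspaces `V₁`, `V₂` of `V`). -/
def IsProductAction (W : Subgroup (V ≃ₗ[ℂ] V)) {V₁ V₂ : Submodule ℂ V}
    (W₁ : Subgroup (V₁ ≃ₗ[ℂ] V₁)) (W₂ : Subgroup (V₂ ≃ₗ[ℂ] V₂)) : Prop :=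
  ∀ g : V ≃ₗ[ℂ] V, g ∈ W ↔
    ∃ w₁ ∈ W₁, ∃ w₂ ∈ W₂,
      (∀ v : V₁, g (v : V) = (w₁ v : V)) ∧ (∀ v : V₂, g (v : V) = (w₂ v : V))

/-- A reflection group `W` on `V` is irreducible if it cannot be expressed as a direct product
`W₁ × W₂` of reflection groups acting on `V = V₁ ⊕ V₂` unless `V₁ = 0` or `V₂ = 0`. -/
def IsIrreducibleReflectionGroup (W : Subgroup (V ≃ₗ[ℂ] V)) : Prop :=
  IsComplexReflectionGroup W ∧
    ∀ V₁ V₂ : Submodule ℂ V, IsCompl V₁ V₂ →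
      (∃ (W₁ : Subgroup (V₁ ≃ₗ[ℂ] V₁)) (W₂ : Subgroup (V₂ ≃ₗ[ℂ] V₂)),
        IsComplexReflectionGroup W₁ ∧ IsComplexReflectionGroup W₂ ∧ IsProductAction W W₁ W₂) →
      V₁ = ⊥ ∨ V₂ = ⊥

end Reflections

/-! ### The fermionic diagonal coinvariant ring -/

section Coinvariants

variable {V : Type*} [AddCommGroup V] [Module ℂ V]

variable (V) in
/-- The exterior algebra `∧(V ⊕ V*)`. -/
abbrev Fermions : Type _ := ExteriorAlgebra ℂ (V × Module.Dual ℂ V)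

/-- The action of `g ∈ GL(V)` on `V ⊕ V*`: `g (v, f) = (g v, f ∘ g⁻¹)`. -/
def actLinear (g : V ≃ₗ[ℂ] V) : (V × Module.Dual ℂ V) →ₗ[ℂ] (V × Module.Dual ℂ V) :=
  LinearMap.prodMap (g : V →ₗ[ℂ] V)
    (g.symm.dualMap : Module.Dual ℂ V →ₗ[ℂ] Module.Dual ℂ V)

/-- The induced action of `g ∈ GL(V)` on `∧(V ⊕ V*)` by algebra maps. -/
def act (g : V ≃ₗ[ℂ] V) : Fermions V →ₐ[ℂ] Fermions V :=
  ExteriorAlgebra.map (actLinear g)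

/-- `∧(V ⊕ V*)^W_+`: the `W`-invariant elements with vanishing constant term. -/
def positiveInvariants (W : Subgroup (V ≃ₗ[ℂ] V)) : Set (Fermions V) :=
  {x | (∀ g ∈ W, act g x = x) ∧ ExteriorAlgebra.algebraMapInv x = 0}

/-- The two-sided ideal of `∧(V ⊕ V*)` generated by `∧(V ⊕ V*)^W_+`. -/
def coinvariantIdeal (W : Subgroup (V ≃ₗ[ℂ] V)) : Ideal (Fermions V) :=
  (TwoSidedIdeal.span (positiveInvariants W)).asIdeal

instance (W : Subgroup (V ≃ₗ[ℂ] V)) : (coinvariantIdeal W).IsTwoSided :=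
  inferInstanceAs (TwoSidedIdeal.span (positiveInvariants W)).asIdeal.IsTwoSided

/-- The fermionic diagonal coinvariant ring `DR_W = ∧(V ⊕ V*) / ⟨∧(V ⊕ V*)^W_+⟩`. -/
abbrev DR (W : Subgroup (V ≃ₗ[ℂ] V)) : Type _ := Fermions V ⧸ coinvariantIdeal W

variable (V) in
/-- The piece of `∧(V ⊕ V*)` of bidegree `(i, j)`, with `V` placed in bidegree `(1, 0)` and `V*`
in bidegree `(0, 1)`: the span of the products of `i` elements of `V` followed by `j` elements
of `V*`. -/
def fermionPiece (i j : ℕ) : Submodule ℂ (Fermions V) :=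
  LinearMap.range (ExteriorAlgebra.ι ℂ ∘ₗ LinearMap.inl ℂ V (Module.Dual ℂ V)) ^ i *
    LinearMap.range (ExteriorAlgebra.ι ℂ ∘ₗ LinearMap.inr ℂ V (Module.Dual ℂ V)) ^ j

/-- `(DR_W)_{i,j}`: the image in `DR_W` of the bidegree `(i, j)` piece of `∧(V ⊕ V*)`. -/
def drPiece (W : Subgroup (V ≃ₗ[ℂ] V)) (i j : ℕ) : Submodule ℂ (DR W) :=
  (fermionPiece V i j).map (Ideal.Quotient.mkₐ ℂ (coinvariantIdeal W)).toLinearMap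

end Coinvariants

/-- The bigraded Hilbert series `∑_{i,j ≥ 0} dim M_{i,j} q^i t^j` of a family of (finite-dimensional)
subspaces `M_{i,j}`, as a formal power series in `q` (the variable of index `0`) and `t`
(the variable of index `1`). -/
def hilb {M : Type*} [AddCommGroup M] [Module ℂ M] (piece : ℕ → ℕ → Submodule ℂ M) :
    MvPowerSeries (Fin 2) ℕ :=
  fun m => Module.finrank ℂ (piece (m 0) (m 1))

/-! ### Decorated Motzkin-like paths -/

/-- The steps of a path: up-steps `(1,1)`, down-steps `(1,-1)`, and horizontal steps `(1,0)`
decorated with a `θ` or a `ξ`. -/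
inductive Step : Type
  | up
  | down
  | theta
  | xi
  deriving DecidableEq

instance : Fintype Step where
  elems := {Step.up, Step.down, Step.theta, Step.xi}
  complete := by intro s; cases s <;> decide

/-- The vector of `ℤ²` underlying a step. -/
def Step.vec : Step → ℤ × ℤ
  | .up => (1, 1)
  | .down => (1, -1)
  | .theta => (1, 0)
  | .xi => (1, 0)

/-- `Π(n)`: the `n`-step paths `σ = (s_1, …, s_n)`, starting at the origin. -/
abbrev LatticePath (n : ℕ) : Type := Fin n → Step

namespace LatticePath

variable {n : ℕ}

/-- The point of `ℤ²` reached by `σ` after `k` steps. -/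
def point (σ : LatticePath n) (k : ℕ) : ℤ × ℤ :=
  ∑ i ∈ Finset.univ.filter (fun i : Fin n => (i : ℕ) < k), (σ i).vec

/-- `σ` never sinks below the `x`-axis. -/
def NeverBelow (σ : LatticePath n) : Prop :=
  ∀ k : Fin (n + 1), 0 ≤ (σ.point k).2

instance (σ : LatticePath n) : Decidable σ.NeverBelow :=
  inferInstanceAs (Decidable (∀ k : Fin (n + 1), 0 ≤ (σ.point k).2))

/-- `deg_θ(σ)`: the number of down-steps plus the number of `θ`-horizontal steps. -/
def degTheta (σ : LatticePath n) : ℕ :=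
  (Finset.univ.filter fun i => σ i = Step.down).card +
    (Finset.univ.filter fun i => σ i = Step.theta).card

/-- `deg_ξ(σ)`: the number of down-steps plus the number of `ξ`-horizontal steps. -/
def degXi (σ : LatticePath n) : ℕ :=
  (Finset.univ.filter fun i => σ i = Step.down).card +
    (Finset.univ.filter fun i => σ i = Step.xi).card

end LatticePath

/-- `Π(n)_{≥ 0}`: the paths in `Π(n)` that never sink below the `x`-axis. -/
def nonnegPaths (n : ℕ) : Finset (LatticePath n) :=
  Finset.univ.filter fun σ => σ.NeverBelow

end FermionicCoinvariants

end

noncomputable section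

namespace FermionicCoinvariants

open Module

/-! The coinvariant ideal is principal: for every irreducible `W` it is generated by the Casimir
element `δ = ∑ θ_i ξ_i`. The Hilbert series then follows from the Lefschetz property of `δ` and a
ballot-type count.

Invariants. A reflection of finite order has the form `1 - f ⊗ α` with `f α ≠ 0`, and an element of
`∧(V ⊕ V*)` fixed by it is killed by the rank-one element `α ⊗ f` of `𝔤𝔩(V)`
(`glAct_eq_zero_of_reflOp`). Since `W` acts irreducibly, brackets of these elements spread the
vanishing to all of `𝔤𝔩(V)` (`glAct_eq_zero_of_roots`). A vector `x` of bidegree `(p, q)` killed by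
`𝔤𝔩(V)` has `p = q`, and the identity `casimir` reads `p (n + 1 - p) x = δ · lower x`. Hence `x` is
a multiple of `δ` unless `p = 0`. No decomposition of the exterior powers under `W` is needed.

Dimensions. The operators `raise` (multiplication by `δ`) and `lower` satisfy `[lower, raise] = n -
i - j` in bidegree `(i, j)`, an `sl₂` relation. So multiplication by `δ` from bidegree `(i-1, j-1)`
to `(i, j)` is injective when `i + j ≤ n` and surjective when `i + j > n`. As the `(i, j)` piece of
`∧(V ⊕ V*)` has dimension `C(n,i) C(n,j)`, that of `DR_W` has dimension `C(n,i) C(n,j) - C(n,i-1)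
C(n,j-1)` in the first case and `0` in the second.

Paths. A path with degrees `(i, j)` ends at height `n - i - j`. Removing the last step gives a
recursion which the same difference of binomials satisfies by Pascal's rule; on the forbidden line
`i + j = n + 1` the difference vanishes by symmetry of binomials (`LatticePath.count_eq`). -/

lemma eq_zero_of_eq_neg {M : Type*} [AddCommGroup M] [Module ℂ M] {y : M} (h : y = -y) :
    y = 0 := by
  have : (2 : ℂ) • y = 0 := by rw [two_smul]; nth_rewrite 1 [h]; exact neg_add_cancel y
  simpa using this

/-- Creation and annihilation operators on `F` indexed by `V ⊕ V*`, subject to the canonical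
anticommutation relations: `mulV v`, `mulD f` are the creation operators, `conV f`, `conD v` the
annihilation operators. -/
structure FermionRep (V F : Type*) [AddCommGroup V] [Module ℂ V] [AddCommGroup F] [Module ℂ F] where
  /-- creation by a vector -/
  mulV : V →ₗ[ℂ] End ℂ F
  /-- creation by a covector -/
  mulD : Dual ℂ V →ₗ[ℂ] End ℂ F
  /-- annihilation of vectors by a covector -/
  conV : Dual ℂ V →ₗ[ℂ] End ℂ F
  /-- annihilation of covectors by a vector -/
  conD : V →ₗ[ℂ] End ℂ F
  mulV_mulV : ∀ v w, mulV v * mulV w = -(mulV w * mulV v)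
  mulV_mulD : ∀ v f, mulV v * mulD f = -(mulD f * mulV v)
  mulD_mulD : ∀ f g, mulD f * mulD g = -(mulD g * mulD f)
  conV_conV : ∀ f g, conV f * conV g = -(conV g * conV f)
  conV_conD : ∀ f v, conV f * conD v = -(conD v * conV f)
  conD_conD : ∀ v w, conD v * conD w = -(conD w * conD v)
  conV_mulV : ∀ f v, conV f * mulV v = f v • 1 - mulV v * conV f
  conV_mulD : ∀ f g, conV f * mulD g = -(mulD g * conV f)
  conD_mulV : ∀ v w, conD v * mulV w = -(mulV w * conD v)
  conD_mulD : ∀ v f, conD v * mulD f = f v • 1 - mulD f * conD v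

/-! ### Canonical anticommutation relations and the action of `𝔤𝔩(V)` -/

namespace FermionRep

variable {V F : Type*} [AddCommGroup V] [Module ℂ V] [AddCommGroup F] [Module ℂ F]
  (O : FermionRep V F) (v w : V) (f g : Dual ℂ V)

lemma mulD_mulV : O.mulD f * O.mulV v = -(O.mulV v * O.mulD f) := by
  rw [mulV_mulD, neg_neg]

lemma conD_conV : O.conD v * O.conV f = -(O.conV f * O.conD v) := by
  rw [conV_conD, neg_neg]

lemma mulV_self : O.mulV v * O.mulV v = 0 := eq_zero_of_eq_neg (O.mulV_mulV v v)
lemma mulD_self : O.mulD f * O.mulD f = 0 := eq_zero_of_eq_neg (O.mulD_mulD f f)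

/-! ### Quadratic operators -/

lemma mulV_conV_mul_mulV :
    (O.mulV v * O.conV f) * O.mulV w = O.mulV w * (O.mulV v * O.conV f) + f w • O.mulV v := by
  rw [mul_assoc, conV_mulV, mul_sub, ← mul_assoc, O.mulV_mulV v w]
  simp [mul_assoc, add_comm]

lemma mulV_conV_mul_mulD :
    (O.mulV v * O.conV f) * O.mulD g = O.mulD g * (O.mulV v * O.conV f) := by
  rw [mul_assoc, conV_mulD, mul_neg, ← mul_assoc, O.mulV_mulD v g]
  simp [mul_assoc]

lemma mulV_conV_mul_conV :
    (O.mulV v * O.conV f) * O.conV g = O.conV g * (O.mulV v * O.conV f) - g v • O.conV f := by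
  rw [← mul_assoc (O.conV g), conV_mulV, sub_mul, mul_assoc, mul_assoc, O.conV_conV g f]
  simp

lemma mulV_conV_mul_conD :
    (O.mulV v * O.conV f) * O.conD w = O.conD w * (O.mulV v * O.conV f) := by
  rw [← mul_assoc (O.conD w), conD_mulV, mul_assoc, neg_mul, mul_assoc, conV_conD]
  simp

lemma mulD_conD_mul_mulD :
    (O.mulD f * O.conD v) * O.mulD g = O.mulD g * (O.mulD f * O.conD v) + g v • O.mulD f := by
  rw [mul_assoc, conD_mulD, mul_sub, ← mul_assoc, O.mulD_mulD f g]
  simp [mul_assoc, add_comm]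

lemma mulD_conD_mul_mulV :
    (O.mulD f * O.conD v) * O.mulV w = O.mulV w * (O.mulD f * O.conD v) := by
  rw [mul_assoc, conD_mulV, mul_neg, ← mul_assoc, O.mulD_mulV w f]
  simp [mul_assoc]

lemma mulD_conD_mul_conD :
    (O.mulD f * O.conD v) * O.conD w = O.conD w * (O.mulD f * O.conD v) - f w • O.conD v := by
  rw [← mul_assoc (O.conD w), conD_mulD, sub_mul, mul_assoc, mul_assoc, O.conD_conD w v]
  simp

lemma mulD_conD_mul_conV :
    (O.mulD f * O.conD v) * O.conV g = O.conV g * (O.mulD f * O.conD v) := by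
  rw [← mul_assoc (O.conV g), conV_mulD, mul_assoc, neg_mul, mul_assoc, conD_conV]
  simp

/-- The action of `v ⊗ f ∈ V ⊗ V* = 𝔤𝔩(V)`. -/
def glAct : End ℂ F := O.mulV v * O.conV f - O.mulD f * O.conD v

lemma glAct_mul_mulV : O.glAct v f * O.mulV w = O.mulV w * O.glAct v f + f w • O.mulV v := by
  simp only [glAct, sub_mul, mul_sub, mulV_conV_mul_mulV, mulD_conD_mul_mulV]; abel

lemma glAct_mul_mulD : O.glAct v f * O.mulD g = O.mulD g * O.glAct v f - g v • O.mulD f := by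
  simp only [glAct, sub_mul, mul_sub, mulV_conV_mul_mulD, mulD_conD_mul_mulD]; abel

lemma glAct_mul_conV : O.glAct v f * O.conV g = O.conV g * O.glAct v f - g v • O.conV f := by
  simp only [glAct, sub_mul, mul_sub, mulV_conV_mul_conV, mulD_conD_mul_conV]; abel

lemma glAct_mul_conD : O.glAct v f * O.conD w = O.conD w * O.glAct v f + f w • O.conD v := by
  simp only [glAct, sub_mul, mul_sub, mulV_conV_mul_conD, mulD_conD_mul_conD]; abel

lemma glAct_mul_glAct : O.glAct v f * O.glAct w g =
    O.glAct w g * O.glAct v f + f w • O.glAct v g - g v • O.glAct w f := by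
  have h1 : O.glAct v f * (O.mulV w * O.conV g) = O.mulV w * O.conV g * O.glAct v f +
      f w • (O.mulV v * O.conV g) - g v • (O.mulV w * O.conV f) := by
    rw [← mul_assoc, glAct_mul_mulV, add_mul, mul_assoc, glAct_mul_conV]
    simp only [mul_sub, mul_smul_comm, smul_mul_assoc, mul_assoc]; abel
  have h2 : O.glAct v f * (O.mulD g * O.conD w) = O.mulD g * O.conD w * O.glAct v f +
      f w • (O.mulD g * O.conD v) - g v • (O.mulD f * O.conD w) := by
    rw [← mul_assoc, glAct_mul_mulD, sub_mul, mul_assoc, glAct_mul_conD]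
    simp only [mul_add, mul_smul_comm, smul_mul_assoc, mul_assoc]
  have h3 : O.glAct w g = O.mulV w * O.conV g - O.mulD g * O.conD w := rfl
  have h4 : O.glAct v g = O.mulV v * O.conV g - O.mulD g * O.conD v := rfl
  have h5 : O.glAct w f = O.mulV w * O.conV f - O.mulD f * O.conD w := rfl
  rw [h3, h4, h5, mul_sub, h1, h2, sub_mul, smul_sub, smul_sub]; abel

lemma glAct_add_left : O.glAct (v + w) f = O.glAct v f + O.glAct w f := by
  simp only [glAct, map_add, add_mul, mul_add]; abel

lemma glAct_add_right : O.glAct v (f + g) = O.glAct v f + O.glAct v g := by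
  simp only [glAct, map_add, add_mul, mul_add]; abel

lemma glAct_smul_left (c : ℂ) : O.glAct (c • v) f = c • O.glAct v f := by
  simp [glAct, smul_sub]

lemma glAct_smul_right (c : ℂ) : O.glAct v (c • f) = c • O.glAct v f := by
  simp [glAct, smul_sub]

variable {v w f g}

/-- The annihilator of `x` in `𝔤𝔩(V)` is closed under brackets; this is the case of two rank-one
elements. -/
lemma glAct_bracket {x : F} (h1 : O.glAct v f x = 0) (h2 : O.glAct w g x = 0) :
    f w • O.glAct v g x = g v • O.glAct w f x := by
  have := LinearMap.congr_fun (O.glAct_mul_glAct v w f g) x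
  simp only [End.mul_apply, LinearMap.add_apply, LinearMap.sub_apply, LinearMap.smul_apply, h1, h2,
    map_zero, zero_add] at this
  exact (sub_eq_zero.mp this.symm)

/-- If `v ⊗ f` and `w ⊗ g` kill `x` and `f w ≠ 0`, `f v ≠ 0`, then `v ⊗ g` kills `x`. -/
lemma glAct_edge {x : F} (h1 : O.glAct v f x = 0) (h2 : O.glAct w g x = 0)
    (hv : f v ≠ 0) (hw : f w ≠ 0) : O.glAct v g x = 0 := by
  have hb := O.glAct_bracket h1 h2
  have e1 := LinearMap.congr_fun (O.glAct_mul_glAct v v f g) x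
  have e2 := LinearMap.congr_fun (O.glAct_mul_glAct v w f f) x
  simp only [End.mul_apply, LinearMap.add_apply, LinearMap.sub_apply, LinearMap.smul_apply, h1,
    map_zero, zero_add, smul_zero, sub_zero, zero_sub] at e1 e2
  -- By `e1` and `e2`, `v ⊗ f` acts on the two sides of `hb` by the opposite scalars `f v` and `-f
  -- v`. The common vector therefore equals its own negative after scaling.
  have e3 := congrArg (O.glAct v f) hb
  rw [map_smul, map_smul, e1, e2, smul_neg, smul_comm (f w), smul_comm (g v), ← hb] at e3
  have h4 := eq_zero_of_eq_neg e3
  simpa [hv, hw] using h4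

/-- A set of pairs `(α, λ)` with `λ α ≠ 0` acting irreducibly on `V` generates `𝔤𝔩(V)`. -/
theorem glAct_eq_zero_of_roots [FiniteDimensional ℂ V] (Φ : Set (V × Dual ℂ V))
    (hne : Φ.Nonempty) (hΦ : ∀ p ∈ Φ, p.2 p.1 ≠ 0)
    (hirr : ∀ U : Submodule ℂ V, (∀ p ∈ Φ, p.1 ∈ U ∨ U ≤ LinearMap.ker p.2) → U = ⊥ ∨ U = ⊤)
    {x : F} (hx : ∀ p ∈ Φ, O.glAct p.1 p.2 x = 0) (v : V) (f : Dual ℂ V) :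
    O.glAct v f x = 0 := by
  have key : ∀ s ∈ Φ, ∀ g : Dual ℂ V, O.glAct s.1 g x = 0 := by
    intro s hs
    let Z : Submodule ℂ (Dual ℂ V) :=
      { carrier := {g | O.glAct s.1 g x = 0}
        add_mem' := fun {a b} ha hb => by
          simp only [Set.mem_ofPred_eq] at *
          rw [glAct_add_right, LinearMap.add_apply, ha, hb, add_zero]
        zero_mem' := by simp [glAct]
        smul_mem' := fun c a ha => by
          simp only [Set.mem_ofPred_eq] at *
          rw [glAct_smul_right, LinearMap.smul_apply, ha, smul_zero] }
    have hsZ : s.2 ∈ Z := hx s hs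
    -- Membership in `Z` propagates along pairs of roots with `t.2 u.1 ≠ 0`: `glAct_edge` kills `t.1
    -- ⊗ u.2`, and bracketing `s.1 ⊗ t.2` with it produces `s.1 ⊗ u.2`.
    have hstep : ∀ t ∈ Φ, t.2 ∈ Z → ∀ u ∈ Φ, t.2 u.1 ≠ 0 → u.2 ∈ Z := by
      intro t ht htZ u hu htu
      have h1 := O.glAct_edge (hx t ht) (hx u hu) (hΦ t ht) htu
      have h2 := O.glAct_bracket (show O.glAct s.1 t.2 x = 0 from htZ) h1
      rw [hx t ht, smul_zero] at h2
      exact (smul_eq_zero.mp h2).resolve_left (hΦ t ht)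
    -- The common kernel of the root functionals reached so far. A root whose functional is not
    -- reached must have its vector here, so irreducibility applies to `U`.
    let U : Submodule ℂ V := ⨅ t : {t : V × Dual ℂ V // t ∈ Φ ∧ t.2 ∈ Z}, LinearMap.ker t.1.2
    have hU : U = ⊥ := by
      refine (hirr U ?_).resolve_right ?_
      · intro p hp
        by_cases hpZ : p.2 ∈ Z
        · exact Or.inr (iInf_le (fun t : {t : V × Dual ℂ V // t ∈ Φ ∧ t.2 ∈ Z} =>
            LinearMap.ker t.1.2) ⟨p, hp, hpZ⟩)
        · left
          simp only [U, Submodule.mem_iInf, LinearMap.mem_ker]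
          intro t
          by_contra h
          exact hpZ (hstep t.1 t.2.1 t.2.2 p hp h)
      · intro htop
        have : s.1 ∈ U := htop ▸ Submodule.mem_top
        simp only [U, Submodule.mem_iInf, LinearMap.mem_ker] at this
        exact hΦ s hs (this ⟨s, hs, hsZ⟩)
    have hco : Z.dualCoannihilator = ⊥ := by
      rw [eq_bot_iff, ← hU]
      intro y hy
      simp only [U, Submodule.mem_iInf, LinearMap.mem_ker]
      intro t
      exact (Submodule.mem_dualCoannihilator _).mp hy _ t.2.2
    have hZ : Z = ⊤ := by
      rw [← Subspace.dualCoannihilator_dualAnnihilator_eq (W := Z), hco]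
      simp
    intro g
    have : g ∈ Z := hZ ▸ Submodule.mem_top
    exact this
  let Y : Submodule ℂ V :=
    { carrier := {v | ∀ g, O.glAct v g x = 0}
      add_mem' := fun {a b} ha hb g => by
        rw [glAct_add_left, LinearMap.add_apply, ha, hb, add_zero]
      zero_mem' := by simp [glAct]
      smul_mem' := fun c a ha g => by
        rw [glAct_smul_left, LinearMap.smul_apply, ha, smul_zero] }
  have hY : Y = ⊤ := by
    refine (hirr Y fun p hp => Or.inl (key p hp)).resolve_left ?_
    intro hbot
    obtain ⟨s, hs⟩ := hne
    have : s.1 ∈ Y := key s hs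
    rw [hbot, Submodule.mem_bot] at this
    exact hΦ s hs (by rw [this, map_zero])
  have : v ∈ Y := hY ▸ Submodule.mem_top
  exact this f

/-! ### The operator of a reflection -/

variable (v f)

/-- The operator induced by the reflection `1 - f ⊗ v`. -/
def reflOp (z : ℂ) : End ℂ F := (1 - O.mulV v * O.conV f) * (1 + z • (O.mulD f * O.conD v))

lemma mulV_conV_sq : (O.mulV v * O.conV f) * (O.mulV v * O.conV f) =
    f v • (O.mulV v * O.conV f) := by
  rw [← mul_assoc, mulV_conV_mul_mulV, add_mul, smul_mul_assoc, ← mul_assoc, mulV_self]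
  simp

lemma mulD_conD_sq : (O.mulD f * O.conD v) * (O.mulD f * O.conD v) =
    f v • (O.mulD f * O.conD v) := by
  rw [← mul_assoc, mulD_conD_mul_mulD, add_mul, smul_mul_assoc, ← mul_assoc, mulD_self]
  simp

lemma mulV_conV_comm_mulD_conD : (O.mulV v * O.conV f) * (O.mulD g * O.conD w) =
    (O.mulD g * O.conD w) * (O.mulV v * O.conV f) := by
  rw [← mul_assoc, mulV_conV_mul_mulD, mul_assoc, mulV_conV_mul_conD, mul_assoc]

/-- Together with `reflOp_mul_mulD` this determines how `reflOp` moves past creation operators. The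
quadratic term drops out because `mulV v` squares to zero. -/
lemma reflOp_mul_mulV (z : ℂ) :
    O.reflOp v f z * O.mulV w = O.mulV (w - f w • v) * O.reflOp v f z := by
  have h1 : (1 + z • (O.mulD f * O.conD v)) * O.mulV w =
      O.mulV w * (1 + z • (O.mulD f * O.conD v)) := by
    rw [add_mul, mul_add, smul_mul_assoc, mulD_conD_mul_mulV, mul_smul_comm, one_mul, mul_one]
  have h2 : (1 - O.mulV v * O.conV f) * O.mulV w =
      O.mulV (w - f w • v) * (1 - O.mulV v * O.conV f) := by
    rw [sub_mul, mulV_conV_mul_mulV, map_sub, map_smul, sub_mul, mul_sub, mul_sub, smul_mul_assoc,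
      smul_mul_assoc, ← mul_assoc (O.mulV v), mulV_self]
    simp; abel
  rw [reflOp, mul_assoc, h1, ← mul_assoc, h2, mul_assoc]

lemma reflOp_mul_mulD (z : ℂ) :
    O.reflOp v f z * O.mulD g = O.mulD (g + (z * g v) • f) * O.reflOp v f z := by
  have h1 : (1 - O.mulV v * O.conV f) * O.mulD g = O.mulD g * (1 - O.mulV v * O.conV f) := by
    rw [sub_mul, mul_sub, mulV_conV_mul_mulD, one_mul, mul_one]
  have h3 : (1 - O.mulV v * O.conV f) * O.mulD f = O.mulD f * (1 - O.mulV v * O.conV f) := by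
    rw [sub_mul, mul_sub, mulV_conV_mul_mulD, one_mul, mul_one]
  have h2 : (1 + z • (O.mulD f * O.conD v)) * O.mulD g =
      (O.mulD g + (z * g v) • O.mulD f) * (1 + z • (O.mulD f * O.conD v)) := by
    rw [add_mul, smul_mul_assoc, mulD_conD_mul_mulD, add_mul, mul_add, mul_add, smul_mul_assoc,
      mul_smul_comm, mul_smul_comm, smul_mul_assoc, ← mul_assoc (O.mulD f), mulD_self]
    simp [smul_smul]; abel
  have h4 : (1 - O.mulV v * O.conV f) * (O.mulD g + (z * g v) • O.mulD f) =
      O.mulD (g + (z * g v) • f) * (1 - O.mulV v * O.conV f) := by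
    rw [mul_add, h1, mul_smul_comm, h3, map_add, map_smul, add_mul, smul_mul_assoc]
  rw [reflOp, mul_assoc, h2, ← mul_assoc, h4, mul_assoc]

/-- An element fixed by a reflection `1 - f ⊗ v` with `f v ≠ 0` is killed by `v ⊗ f`. -/
lemma glAct_eq_zero_of_reflOp {z : ℂ} (hz : z * (1 - f v) = 1) (hc : f v ≠ 0) {x : F}
    (hx : O.reflOp v f z x = x) : O.glAct v f x = 0 := by
  have hz0 : z ≠ 0 := left_ne_zero_of_mul_eq_one hz
  -- `u` and `d` commute and each is `f v` times an idempotent. On joint eigenvectors `reflOp` acts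
  -- by `1`, `1 - f v`, its inverse `z`, or `1` again; as `1 - f v ≠ 1`, the value `1` forces `u`
  -- and `d` to agree. The computation below extracts `u x = d x` without diagonalizing.
  set u := O.mulV v * O.conV f with hu
  set d := O.mulD f * O.conD v with hd
  have huu : ∀ y, u (u y) = f v • u y := fun y => LinearMap.congr_fun (O.mulV_conV_sq v f) y
  have hdd : ∀ y, d (d y) = f v • d y := fun y => LinearMap.congr_fun (O.mulD_conD_sq v f) y
  have hud : ∀ y, u (d y) = d (u y) :=
    fun y => LinearMap.congr_fun (O.mulV_conV_comm_mulD_conD v f) y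
  have h0 : z • d x - u x - z • u (d x) = 0 := by
    have : x + z • d x - u (x + z • d x) = x := hx
    rw [map_add, map_smul] at this
    have h := sub_eq_zero.mpr this
    rw [← h]; abel
  have h1 := congrArg u h0
  have h2 := congrArg d h0
  simp only [map_sub, map_smul, map_zero, huu, hdd, ← hud, smul_smul] at h1 h2
  have e1 : f v • u x = u (d x) := by
    have : (z * (1 - f v)) • u (d x) - f v • u x = 0 := by
      rw [← h1]; module
    rw [hz, one_smul] at this
    exact (sub_eq_zero.mp this).symm
  have e2 : f v • d x = u (d x) := by
    have : z • (f v • d x - u (d x)) = 0 := by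
      have h3 : (z * f v) • d x - (z * (1 - f v)) • u (d x) - (z * f v) • u (d x) = 0 := by
        rw [hz, one_smul]; exact h2
      rw [← h3]; module
    exact sub_eq_zero.mp ((smul_eq_zero.mp this).resolve_left hz0)
  have : f v • (u x - d x) = 0 := by rw [smul_sub, e1, e2, sub_self]
  exact (smul_eq_zero.mp this).resolve_left hc

end FermionRep

/-! ### Independent families of submodules -/

section Independent

variable {κ M : Type*} [AddCommGroup M] [Module ℂ M] {E : κ → Submodule ℂ M}

/-- The modular law reduces this to independence. With `⨆ G = ⊤` it identifies `E` with `G`; with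
`G` the components of the image of `raise` it cuts the ideal into bidegrees. -/
lemma inf_iSup_eq_of_iSupIndep (hE : iSupIndep E) {G : κ → Submodule ℂ M} (hG : ∀ p, G p ≤ E p)
    (p : κ) : E p ⊓ ⨆ q, G q = G p := by
  refine le_antisymm ?_ (le_inf (hG p) (le_iSup G p))
  have h1 : ⨆ q, G q ≤ G p ⊔ ⨆ (q) (_ : q ≠ p), E q := by
    refine iSup_le fun q => ?_
    by_cases hq : q = p
    · exact hq ▸ le_sup_left
    · exact (hG q).trans (le_sup_of_le_right (le_iSup₂_of_le (f := fun q (_ : q ≠ p) => E q) q hq le_rfl))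
  calc E p ⊓ ⨆ q, G q ≤ (G p ⊔ ⨆ (q) (_ : q ≠ p), E q) ⊓ E p := by
        rw [inf_comm]; exact inf_le_inf_right _ h1
    _ = G p ⊔ (⨆ (q) (_ : q ≠ p), E q) ⊓ E p := sup_inf_assoc_of_le _ (hG p)
    _ = G p := by rw [inf_comm, (hE p).eq_bot, sup_bot_eq]

lemma exists_finset_sum_of_iSup_eq_top (h : ⨆ p, E p = ⊤) (x : M) :
    ∃ (s : Finset κ) (y : κ → M), (∀ p, y p ∈ E p) ∧ x = ∑ p ∈ s, y p := by
  classical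
  obtain ⟨g, hg⟩ := (Submodule.mem_iSup_iff_exists_dfinsupp' E x).mp (h ▸ Submodule.mem_top)
  exact ⟨g.support, fun p => g p, fun p => (g p).2, hg.symm⟩

lemma apply_component_eq_zero (hE : iSupIndep E) {T : End ℂ M} (hT : ∀ p, ∀ z ∈ E p, T z ∈ E p)
    {s : Finset κ} {y : κ → M} (hy : ∀ p, y p ∈ E p) (h : T (∑ p ∈ s, y p) = 0) :
    ∀ p ∈ s, T (y p) = 0 := by
  classical
  rw [map_sum] at h
  exact (iSupIndep_iff_finsetSum_eq_zero_imp_eq_zero E).mp hE s (fun p => T (y p))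
    (fun p _ => hT p _ (hy p)) h

end Independent

/-! ### Number operators, the `sl₂` relation and the Casimir identity -/

namespace FermionRep

variable {V F : Type*} [AddCommGroup V] [Module ℂ V] [AddCommGroup F] [Module ℂ F]
  (O : FermionRep V F) {ι : Type*} [Fintype ι] (b : Basis ι ℂ V)

/-- The number operator of the `V`-variables. -/
def numV : End ℂ F := ∑ i, O.mulV (b i) * O.conV (b.coord i)

/-- The number operator of the `V*`-variables. -/
def numD : End ℂ F := ∑ i, O.mulD (b.coord i) * O.conD (b i)

/-- Multiplication by the Casimir element. -/
def raise : End ℂ F := ∑ i, O.mulV (b i) * O.mulD (b.coord i)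

/-- The operator adjoint to `raise`. -/
def lower : End ℂ F := ∑ i, O.conD (b i) * O.conV (b.coord i)

lemma sum_smul_mulV (v : V) : ∑ i, b.coord i v • O.mulV (b i) = O.mulV v := by
  simp_rw [← map_smul, ← map_sum, Basis.coord_apply, b.sum_repr]

lemma sum_smul_conD (v : V) : ∑ i, b.coord i v • O.conD (b i) = O.conD v := by
  simp_rw [← map_smul, ← map_sum, Basis.coord_apply, b.sum_repr]

lemma sum_smul_mulD (f : Dual ℂ V) : ∑ i, f (b i) • O.mulD (b.coord i) = O.mulD f := by
  simp_rw [← map_smul, ← map_sum, b.sum_dual_apply_smul_coord]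

lemma sum_smul_conV (f : Dual ℂ V) : ∑ i, f (b i) • O.conV (b.coord i) = O.conV f := by
  simp_rw [← map_smul, ← map_sum, b.sum_dual_apply_smul_coord]

lemma numV_mul_mulV (v : V) : O.numV b * O.mulV v = O.mulV v * O.numV b + O.mulV v := by
  simp only [numV, Finset.sum_mul, mulV_conV_mul_mulV, Finset.sum_add_distrib, sum_smul_mulV,
    Finset.mul_sum]

lemma numV_mul_mulD (f : Dual ℂ V) : O.numV b * O.mulD f = O.mulD f * O.numV b := by
  simp only [numV, Finset.sum_mul, mulV_conV_mul_mulD, Finset.mul_sum]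

lemma numV_mul_conV (f : Dual ℂ V) : O.numV b * O.conV f = O.conV f * O.numV b - O.conV f := by
  simp only [numV, Finset.sum_mul, mulV_conV_mul_conV, Finset.sum_sub_distrib, sum_smul_conV,
    Finset.mul_sum]

lemma numV_mul_conD (v : V) : O.numV b * O.conD v = O.conD v * O.numV b := by
  simp only [numV, Finset.sum_mul, mulV_conV_mul_conD, Finset.mul_sum]

lemma numD_mul_mulD (f : Dual ℂ V) : O.numD b * O.mulD f = O.mulD f * O.numD b + O.mulD f := by
  simp only [numD, Finset.sum_mul, mulD_conD_mul_mulD, Finset.sum_add_distrib, sum_smul_mulD,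
    Finset.mul_sum]

lemma numD_mul_mulV (v : V) : O.numD b * O.mulV v = O.mulV v * O.numD b := by
  simp only [numD, Finset.sum_mul, mulD_conD_mul_mulV, Finset.mul_sum]

lemma numD_mul_conD (v : V) : O.numD b * O.conD v = O.conD v * O.numD b - O.conD v := by
  simp only [numD, Finset.sum_mul, mulD_conD_mul_conD, Finset.sum_sub_distrib, sum_smul_conD,
    Finset.mul_sum]

lemma numD_mul_conV (f : Dual ℂ V) : O.numD b * O.conV f = O.conV f * O.numD b := by
  simp only [numD, Finset.sum_mul, mulD_conD_mul_conV, Finset.mul_sum]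

lemma lower_mul_mulV (v : V) : O.lower b * O.mulV v = O.mulV v * O.lower b + O.conD v := by
  have h : ∀ i, O.conD (b i) * O.conV (b.coord i) * O.mulV v =
      O.mulV v * (O.conD (b i) * O.conV (b.coord i)) + b.coord i v • O.conD (b i) := fun i => by
    rw [mul_assoc, conV_mulV, mul_sub, ← mul_assoc, conD_mulV, neg_mul, mul_smul_comm, mul_one,
      mul_assoc]
    abel
  simp only [lower, Finset.sum_mul, h, Finset.sum_add_distrib, sum_smul_conD, Finset.mul_sum]

lemma lower_mul_mulD (f : Dual ℂ V) :
    O.lower b * O.mulD f = O.mulD f * O.lower b - O.conV f := by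
  have h : ∀ i, O.conD (b i) * O.conV (b.coord i) * O.mulD f =
      O.mulD f * (O.conD (b i) * O.conV (b.coord i)) - f (b i) • O.conV (b.coord i) := fun i => by
    rw [mul_assoc, conV_mulD, mul_neg, ← mul_assoc, conD_mulD, sub_mul, smul_mul_assoc, one_mul,
      mul_assoc]
    abel
  simp only [lower, Finset.sum_mul, h, Finset.sum_sub_distrib, sum_smul_conV, Finset.mul_sum]

/-- The `sl₂` relation. The constant `Fintype.card ι` collects one contraction `b.coord i (b i) = 1`
for each basis vector. -/
lemma lower_mul_raise : O.lower b * O.raise b =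
    O.raise b * O.lower b + ((Fintype.card ι : ℂ) • 1 - O.numV b - O.numD b) := by
  have h : ∀ i, O.lower b * (O.mulV (b i) * O.mulD (b.coord i)) =
      O.mulV (b i) * O.mulD (b.coord i) * O.lower b + ((1 : ℂ) • 1 -
        O.mulV (b i) * O.conV (b.coord i) - O.mulD (b.coord i) * O.conD (b i)) := fun i => by
    rw [← mul_assoc, lower_mul_mulV, add_mul, mul_assoc, lower_mul_mulD, conD_mulD, mul_sub,
      Basis.coord_apply, Basis.repr_self, Finsupp.single_eq_same, mul_assoc]
    abel
  rw [raise, Finset.mul_sum, Finset.sum_mul]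
  simp only [h, Finset.sum_add_distrib, Finset.sum_sub_distrib, numV, numD]
  rw [Finset.sum_const, Finset.card_univ, ← Nat.cast_smul_eq_nsmul ℂ, one_smul]

/-- The identity of `𝔤𝔩(V)` measures the difference of the two degrees, so a bihomogeneous nonzero
vector killed by `𝔤𝔩(V)` has equal degrees. -/
lemma sum_glAct : ∑ i, O.glAct (b i) (b.coord i) = O.numV b - O.numD b := by
  simp only [glAct, Finset.sum_sub_distrib, numV, numD]

lemma numV_mul_raise : O.numV b * O.raise b = O.raise b * O.numV b + O.raise b := by
  have h : ∀ i, O.numV b * (O.mulV (b i) * O.mulD (b.coord i)) =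
      O.mulV (b i) * O.mulD (b.coord i) * O.numV b + O.mulV (b i) * O.mulD (b.coord i) :=
    fun i => by rw [← mul_assoc, numV_mul_mulV, add_mul, mul_assoc, numV_mul_mulD, mul_assoc]
  simp only [raise, Finset.mul_sum, h, Finset.sum_add_distrib, Finset.sum_mul]

lemma numD_mul_raise : O.numD b * O.raise b = O.raise b * O.numD b + O.raise b := by
  have h : ∀ i, O.numD b * (O.mulV (b i) * O.mulD (b.coord i)) =
      O.mulV (b i) * O.mulD (b.coord i) * O.numD b + O.mulV (b i) * O.mulD (b.coord i) :=
    fun i => by rw [← mul_assoc, numD_mul_mulV, mul_assoc, numD_mul_mulD, mul_add, mul_assoc]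
  simp only [raise, Finset.mul_sum, h, Finset.sum_add_distrib, Finset.sum_mul]

lemma numV_mul_lower : O.numV b * O.lower b = O.lower b * O.numV b - O.lower b := by
  have h : ∀ i, O.numV b * (O.conD (b i) * O.conV (b.coord i)) =
      O.conD (b i) * O.conV (b.coord i) * O.numV b - O.conD (b i) * O.conV (b.coord i) :=
    fun i => by rw [← mul_assoc, numV_mul_conD, mul_assoc, numV_mul_conV, mul_sub, mul_assoc]
  simp only [lower, Finset.mul_sum, h, Finset.sum_sub_distrib, Finset.sum_mul]

lemma numD_mul_lower : O.numD b * O.lower b = O.lower b * O.numD b - O.lower b := by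
  have h : ∀ i, O.numD b * (O.conD (b i) * O.conV (b.coord i)) =
      O.conD (b i) * O.conV (b.coord i) * O.numD b - O.conD (b i) * O.conV (b.coord i) :=
    fun i => by rw [← mul_assoc, numD_mul_conD, sub_mul, mul_assoc, numD_mul_conV, mul_assoc]
  simp only [lower, Finset.mul_sum, h, Finset.sum_sub_distrib, Finset.sum_mul]

lemma numV_mul_glAct (v : V) (f : Dual ℂ V) :
    O.numV b * O.glAct v f = O.glAct v f * O.numV b := by
  rw [glAct, mul_sub, ← mul_assoc, ← mul_assoc, numV_mul_mulV, numV_mul_mulD, add_mul, mul_assoc,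
    mul_assoc, numV_mul_conV, numV_mul_conD, mul_sub, sub_mul, mul_assoc, mul_assoc]
  abel

lemma numD_mul_glAct (v : V) (f : Dual ℂ V) :
    O.numD b * O.glAct v f = O.glAct v f * O.numD b := by
  rw [glAct, mul_sub, ← mul_assoc, ← mul_assoc, numD_mul_mulV, numD_mul_mulD, add_mul, mul_assoc,
    mul_assoc, numD_mul_conV, numD_mul_conD, mul_sub, sub_mul, mul_assoc, mul_assoc]
  abel

/-- The quadratic Casimir identity on a vector killed by `𝔤𝔩(V)`. -/
lemma casimir {x : F} (hx : ∀ v f, O.glAct v f x = 0) :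
    (Fintype.card ι + 1 : ℂ) • O.numV b x - O.numV b (O.numV b x) = O.raise b (O.lower b x) := by
  have h1 : ∀ j, (Fintype.card ι : ℂ) • O.conV (b.coord j) x - O.numV b (O.conV (b.coord j) x) =
      O.mulD (b.coord j) (O.lower b x) := by
    intro j
    -- Contracting `𝔤𝔩(V) x = 0` over one index and then applying `mulV (b j)` and summing over `j`
    -- assembles the quadratic Casimir from rank-one elements.
    have e1 : (∑ i, O.conV (b.coord i) * O.glAct (b i) (b.coord j)) x = 0 := by
      rw [LinearMap.sum_apply]
      exact Finset.sum_eq_zero fun i _ => by rw [End.mul_apply, hx, map_zero]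
    have e2 : ∀ i, O.conV (b.coord i) * O.glAct (b i) (b.coord j) =
        (1 : ℂ) • O.conV (b.coord j) - O.mulV (b i) * O.conV (b.coord i) * O.conV (b.coord j) -
          O.mulD (b.coord j) * (O.conD (b i) * O.conV (b.coord i)) := fun i => by
      rw [glAct, mul_sub, ← mul_assoc, ← mul_assoc, conV_mulV, conV_mulD, neg_mul, mul_assoc,
        conV_conD, Basis.coord_apply, Basis.repr_self, Finsupp.single_eq_same, sub_mul,
        smul_mul_assoc, one_mul, mul_neg, neg_neg]
    simp only [e2, Finset.sum_sub_distrib, ← Finset.sum_mul, ← Finset.mul_sum] at e1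
    rw [Finset.sum_const, Finset.card_univ, ← Nat.cast_smul_eq_nsmul ℂ, one_smul] at e1
    exact sub_eq_zero.mp e1
  have h2 : ∑ j, O.mulV (b j) ((Fintype.card ι : ℂ) • O.conV (b.coord j) x -
      O.numV b (O.conV (b.coord j) x)) = O.raise b (O.lower b x) := by
    simp only [h1, raise, LinearMap.sum_apply, End.mul_apply]
  rw [← h2]
  have h3 : ∀ j, O.mulV (b j) (O.numV b (O.conV (b.coord j) x)) =
      (O.mulV (b j) * O.conV (b.coord j)) (O.numV b x) -
        (O.mulV (b j) * O.conV (b.coord j)) x := fun j => by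
    have := LinearMap.congr_fun (O.numV_mul_conV b (b.coord j)) x
    simp only [End.mul_apply, LinearMap.sub_apply] at this ⊢
    rw [this, map_sub]
  have h4 : ∀ y, ∑ j, (O.mulV (b j) * O.conV (b.coord j)) y = O.numV b y := fun y => by
    rw [numV, LinearMap.sum_apply]
  have h5 : ∀ j, O.mulV (b j) (O.conV (b.coord j) x) = (O.mulV (b j) * O.conV (b.coord j)) x :=
    fun j => rfl
  simp only [map_sub, map_smul, h3, h5, Finset.sum_sub_distrib, ← Finset.smul_sum, h4]
  module

/-! ### Weight spaces -/

/-- The joint eigenspaces of the two number operators. -/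
def weight (p : ℤ × ℤ) : Submodule ℂ F :=
  (O.numV b).eigenspace (p.1 : ℂ) ⊓ (O.numD b).eigenspace (p.2 : ℂ)

variable {b} in
lemma mem_weight {p : ℤ × ℤ} {x : F} :
    x ∈ O.weight b p ↔ O.numV b x = (p.1 : ℂ) • x ∧ O.numD b x = (p.2 : ℂ) • x := by
  simp only [weight, Submodule.mem_inf, End.mem_eigenspace_iff]

/-- Joint eigenspaces for integers `(p, q)` lie in eigenspaces of the single operator `numV + i
numD` with eigenvalue `p + q i`, and these Gaussian integers are distinct. -/
lemma weight_iSupIndep : iSupIndep (O.weight b) := by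
  have h := (End.eigenspaces_iSupIndep (O.numV b + Complex.I • O.numD b)).comp
    (f := fun p : ℤ × ℤ => (p.1 : ℂ) + p.2 * Complex.I) (fun p q h => by
      have h1 := congrArg Complex.re h
      have h2 := congrArg Complex.im h
      simp at h1 h2
      exact Prod.ext h1 h2)
  refine h.mono fun p x hx => ?_
  rw [mem_weight] at hx
  simp only [Function.comp, End.mem_eigenspace_iff, LinearMap.add_apply, LinearMap.smul_apply, hx]
  module

variable {b}

lemma raise_mem_weight {p : ℤ × ℤ} {x : F} (hx : x ∈ O.weight b p) :
    O.raise b x ∈ O.weight b (p.1 + 1, p.2 + 1) := by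
  rw [mem_weight] at *
  have h1 := LinearMap.congr_fun (O.numV_mul_raise b) x
  have h2 := LinearMap.congr_fun (O.numD_mul_raise b) x
  simp only [End.mul_apply, LinearMap.add_apply, hx, map_smul] at h1 h2
  rw [h1, h2]
  push_cast
  constructor <;> module

lemma lower_mem_weight {p : ℤ × ℤ} {x : F} (hx : x ∈ O.weight b p) :
    O.lower b x ∈ O.weight b (p.1 - 1, p.2 - 1) := by
  rw [mem_weight] at *
  have h1 := LinearMap.congr_fun (O.numV_mul_lower b) x
  have h2 := LinearMap.congr_fun (O.numD_mul_lower b) x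
  simp only [End.mul_apply, LinearMap.sub_apply, hx, map_smul] at h1 h2
  rw [h1, h2]
  push_cast
  constructor <;> module

lemma raise_pow_mem_weight {p : ℤ × ℤ} {x : F} (hx : x ∈ O.weight b p) (k : ℕ) :
    (O.raise b ^ k) x ∈ O.weight b (p.1 + k, p.2 + k) := by
  induction k with
  | zero => simpa using hx
  | succ k ih =>
    rw [pow_succ', End.mul_apply]
    have := O.raise_mem_weight ih
    push_cast
    simpa [add_assoc] using this

lemma lower_pow_mem_weight {p : ℤ × ℤ} {x : F} (hx : x ∈ O.weight b p) (k : ℕ) :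
    (O.lower b ^ k) x ∈ O.weight b (p.1 - k, p.2 - k) := by
  induction k with
  | zero => simpa using hx
  | succ k ih =>
    rw [pow_succ', End.mul_apply]
    have := O.lower_mem_weight ih
    push_cast
    simpa [sub_sub] using this

lemma glAct_mem_weight {p : ℤ × ℤ} {x : F} (hx : x ∈ O.weight b p) (v : V) (f : Dual ℂ V) :
    O.glAct v f x ∈ O.weight b p := by
  rw [mem_weight] at *
  have h1 := LinearMap.congr_fun (O.numV_mul_glAct b v f) x
  have h2 := LinearMap.congr_fun (O.numD_mul_glAct b v f) x
  simp only [End.mul_apply, hx, map_smul] at h1 h2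
  exact ⟨h1, h2⟩

lemma lower_raise_apply {p : ℤ × ℤ} {x : F} (hx : x ∈ O.weight b p) :
    O.lower b (O.raise b x) =
      O.raise b (O.lower b x) + (Fintype.card ι - p.1 - p.2 : ℂ) • x := by
  have h := LinearMap.congr_fun (O.lower_mul_raise b) x
  rw [mem_weight] at hx
  simp only [End.mul_apply, LinearMap.add_apply, LinearMap.sub_apply, LinearMap.smul_apply,
    End.one_apply, hx] at h
  rw [h]
  module

/-- The iterated `sl₂` commutator. The scalar is the sum of the weights `n - p.1 - p.2 + 2 l` for `0
≤ l ≤ k`. -/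
lemma lower_pow_raise_apply (k : ℕ) : ∀ {p : ℤ × ℤ} {x : F}, x ∈ O.weight b p →
    (O.lower b ^ (k + 1)) (O.raise b x) = O.raise b ((O.lower b ^ (k + 1)) x) +
      ((k + 1) * (Fintype.card ι - p.1 - p.2 + k) : ℂ) • (O.lower b ^ k) x := by
  induction k with
  | zero => intro p x hx; simp [O.lower_raise_apply hx]
  | succ k ih =>
    intro p x hx
    rw [pow_succ (O.lower b) (k + 1), End.mul_apply, O.lower_raise_apply hx, map_add, map_smul,
      ih (O.lower_mem_weight hx), End.mul_apply, pow_succ (O.lower b) k, End.mul_apply]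
    push_cast
    module

/-- Injectivity of the Lefschetz operator below the middle degree. -/
lemma eq_zero_of_raise_eq_zero (hneg : ∀ p : ℤ × ℤ, p.1 < 0 → O.weight b p = ⊥)
    {p : ℤ × ℤ} (hp : p.1 + p.2 < Fintype.card ι) {x : F} (hx : x ∈ O.weight b p)
    (h : O.raise b x = 0) : x = 0 := by
  -- Since `raise x = 0`, the commutator formula leaves only a nonzero multiple of `lower ^ k x`.
  -- Descent on `k` starts where the first degree has become negative.
  have step : ∀ k, (O.lower b ^ (k + 1)) x = 0 → (O.lower b ^ k) x = 0 := by
    intro k hk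
    have e := O.lower_pow_raise_apply k hx
    rw [h, hk, map_zero, map_zero, zero_add] at e
    refine (smul_eq_zero.mp e.symm).resolve_left ?_
    have : (((k + 1) * (Fintype.card ι - p.1 - p.2 + k) : ℤ) : ℂ) ≠ 0 := by
      rw [Int.cast_ne_zero]
      exact mul_ne_zero (by omega) (by omega)
    push_cast at this
    exact this
  have hk : ∃ k, (O.lower b ^ k) x = 0 := by
    refine ⟨(p.1 + 1).toNat, ?_⟩
    have := O.lower_pow_mem_weight hx (p.1 + 1).toNat
    rw [hneg _ (by simp only; omega)] at this
    exact this
  obtain ⟨k, hk⟩ := hk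
  induction k with
  | zero => simpa using hk
  | succ k ih => exact ih (step k hk)

/-- Surjectivity of the Lefschetz operator above the middle degree. -/
lemma mem_map_raise (hbig : ∀ p : ℤ × ℤ, Fintype.card ι < p.1 → O.weight b p = ⊥)
    {p : ℤ × ℤ} (hp : Fintype.card ι < p.1 + p.2) {x : F} (hx : x ∈ O.weight b p) :
    x ∈ (O.weight b (p.1 - 1, p.2 - 1)).map (O.raise b) := by
  -- The commutator formula for `raise ^ k x` has scalar `(k + 1) (n - p.1 - p.2 - k)`, negative
  -- here, and its other term is visibly in the image. Descent on `k` starts where the first degree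
  -- exceeds `n`.
  have step : ∀ k, (O.lower b ^ (k + 1)) ((O.raise b ^ (k + 1)) x) ∈
      (O.weight b (p.1 - 1, p.2 - 1)).map (O.raise b) →
      (O.lower b ^ k) ((O.raise b ^ k) x) ∈ (O.weight b (p.1 - 1, p.2 - 1)).map (O.raise b) := by
    intro k hk
    have hy := O.raise_pow_mem_weight hx k
    have e := O.lower_pow_raise_apply k hy
    have hz := O.lower_pow_mem_weight hy (k + 1)
    have hw : ((p.1 + k, p.2 + k).1 - ((k + 1 : ℕ) : ℤ), (p.1 + k, p.2 + k).2 - ((k + 1 : ℕ) : ℤ))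
        = (p.1 - 1, p.2 - 1) := by
      push_cast; ext <;> simp <;> ring
    rw [hw] at hz
    rw [pow_succ' (O.raise b), End.mul_apply, e] at hk
    have h2 := (Submodule.add_mem_iff_right _ (Submodule.mem_map_of_mem hz)).mp hk
    refine (Submodule.smul_mem_iff _ ?_).mp h2
    have : (((k + 1) * (Fintype.card ι - (p.1 + k) - (p.2 + k) + k) : ℤ) : ℂ) ≠ 0 := by
      rw [Int.cast_ne_zero]
      exact mul_ne_zero (by omega) (by omega)
    push_cast at this ⊢
    exact this
  have hk : ∃ k, (O.lower b ^ k) ((O.raise b ^ k) x) ∈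
      (O.weight b (p.1 - 1, p.2 - 1)).map (O.raise b) := by
    refine ⟨(Fintype.card ι + 1 - p.1).toNat, ?_⟩
    have := O.raise_pow_mem_weight hx (Fintype.card ι + 1 - p.1).toNat
    rw [hbig _ (by simp only; omega), Submodule.mem_bot] at this
    rw [this, map_zero]
    exact zero_mem _
  obtain ⟨k, hk⟩ := hk
  induction k with
  | zero => simpa using hk
  | succ k ih => exact ih (step k hk)

/-- The vectors killed by `𝔤𝔩(V)` lie in the weight space `(0, 0)` up to the image of `raise`. -/
lemma mem_sup_of_glAct_eq_zero (htop : ⨆ p, O.weight b p = ⊤)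
    (hbig : ∀ p : ℤ × ℤ, Fintype.card ι < p.1 → O.weight b p = ⊥)
    {x : F} (hx : ∀ v f, O.glAct v f x = 0) :
    x ∈ O.weight b (0, 0) ⊔ LinearMap.range (O.raise b) := by
  obtain ⟨s, y, hy, rfl⟩ := exists_finset_sum_of_iSup_eq_top htop x
  refine Submodule.sum_mem _ fun p hp => ?_
  have hz : ∀ v f, O.glAct v f (y p) = 0 := fun v f =>
    apply_component_eq_zero (O.weight_iSupIndep b)
      (fun q z hq => O.glAct_mem_weight hq v f) hy (hx v f) p hp
  have hw := (O.mem_weight).mp (hy p)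
  have h1 : ((p.1 - p.2 : ℤ) : ℂ) • y p = 0 := by
    have := LinearMap.congr_fun (O.sum_glAct b) (y p)
    rw [LinearMap.sum_apply, Finset.sum_eq_zero fun i _ => hz _ _, LinearMap.sub_apply, hw.1,
      hw.2, ← sub_smul] at this
    rw [this]; push_cast; rfl
  have h2 : ((p.1 * (Fintype.card ι + 1 - p.1) : ℤ) : ℂ) • y p = O.raise b (O.lower b (y p)) := by
    rw [← O.casimir b hz, hw.1, map_smul, hw.1]
    push_cast
    module
  by_cases h0 : y p = 0
  · rw [h0]; exact zero_mem _
  have hpp : p.1 = p.2 := by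
    have := (smul_eq_zero.mp h1).resolve_right h0
    rw [Int.cast_eq_zero] at this
    omega
  have hle : p.1 ≤ Fintype.card ι := by
    by_contra h
    have := hy p
    rw [hbig p (by omega)] at this
    exact h0 this
  by_cases hp0 : p.1 = 0
  · refine Submodule.mem_sup_left ?_
    have : p = (0, 0) := Prod.ext hp0 (hpp ▸ hp0)
    exact this ▸ hy p
  · refine Submodule.mem_sup_right ?_
    -- Both factors are nonzero: `p.1 ≠ 0` by assumption and `p.1 ≤ n` by `hle`.
    have hc : ((p.1 * (Fintype.card ι + 1 - p.1) : ℤ) : ℂ) ≠ 0 := by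
      rw [Int.cast_ne_zero]
      exact mul_ne_zero hp0 (by omega)
    exact (Submodule.smul_mem_iff _ hc).mp (h2 ▸ LinearMap.mem_range_self _ _)

end FermionRep

/-! ### Dimension bounds for products and sums of subspaces -/

section Dimension

lemma finrank_submodule_mul_le {A : Type*} [Ring A] [Algebra ℂ A] [FiniteDimensional ℂ A]
    (M N : Submodule ℂ A) :
    finrank ℂ (M * N : Submodule ℂ A) ≤ finrank ℂ M * finrank ℂ N := by
  rw [← Submodule.mulMap_range, ← finrank_tensorProduct (R := ℂ) (S := ℂ)]
  exact LinearMap.finrank_range_le _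

lemma finrank_le_sum_of_iSup_eq_top {κ M : Type*} [Fintype κ] [AddCommGroup M] [Module ℂ M]
    [FiniteDimensional ℂ M] (E : κ → Submodule ℂ M) (h : ⨆ k, E k = ⊤) :
    finrank ℂ M ≤ ∑ k, finrank ℂ (E k) := by
  classical
  rw [← finrank_directSum (R := ℂ) (fun k => E k)]
  have : LinearMap.range (DirectSum.coeLinearMap E) = ⊤ := by
    rw [DirectSum.range_coeLinearMap, h]
  exact LinearMap.finrank_le_finrank_of_surjective (LinearMap.range_eq_top.mp this)

end Dimension

/-! ### The operators on `∧(V ⊕ V*)` and its bigrading -/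

section Concrete

lemma ι_mul_ι_mul_swap {M : Type*} [AddCommGroup M] [Module ℂ M] (m m' : M)
    (x : ExteriorAlgebra ℂ M) : ExteriorAlgebra.ι ℂ m * (ExteriorAlgebra.ι ℂ m' * x) =
      -(ExteriorAlgebra.ι ℂ m' * (ExteriorAlgebra.ι ℂ m * x)) := by
  rw [← mul_assoc, eq_neg_of_add_eq_zero_left (ExteriorAlgebra.ι_add_mul_swap ..), neg_mul,
    mul_assoc]

variable (V : Type*) [AddCommGroup V] [Module ℂ V]

/-- Multiplication and contraction operators on `∧(V ⊕ V*)`. -/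
def fermionRep : FermionRep V (Fermions V) where
  mulV := LinearMap.mul ℂ (Fermions V) ∘ₗ ExteriorAlgebra.ι ℂ ∘ₗ LinearMap.inl ℂ V (Dual ℂ V)
  mulD := LinearMap.mul ℂ (Fermions V) ∘ₗ ExteriorAlgebra.ι ℂ ∘ₗ LinearMap.inr ℂ V (Dual ℂ V)
  conV := (CliffordAlgebra.contractLeft (Q := (0 : QuadraticForm ℂ (V × Dual ℂ V)))) ∘ₗ
    (LinearMap.fst ℂ V (Dual ℂ V)).dualMap
  conD := (CliffordAlgebra.contractLeft (Q := (0 : QuadraticForm ℂ (V × Dual ℂ V)))) ∘ₗ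
    (LinearMap.snd ℂ V (Dual ℂ V)).dualMap ∘ₗ Dual.eval ℂ V
  mulV_mulV v w := by
    refine LinearMap.ext fun x => ?_
    exact ι_mul_ι_mul_swap ..
  mulV_mulD v f := by
    refine LinearMap.ext fun x => ?_
    exact ι_mul_ι_mul_swap ..
  mulD_mulD f g := by
    refine LinearMap.ext fun x => ?_
    exact ι_mul_ι_mul_swap ..
  conV_conV f g := by refine LinearMap.ext fun x => ?_; exact CliffordAlgebra.contractLeft_comm ..
  conV_conD f v := by refine LinearMap.ext fun x => ?_; exact CliffordAlgebra.contractLeft_comm ..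
  conD_conD v w := by refine LinearMap.ext fun x => ?_; exact CliffordAlgebra.contractLeft_comm ..
  conV_mulV f v := by refine LinearMap.ext fun x => ?_; exact CliffordAlgebra.contractLeft_ι_mul ..
  conV_mulD f g := by
    refine LinearMap.ext fun x => ?_
    refine (CliffordAlgebra.contractLeft_ι_mul ..).trans ?_
    have : ((LinearMap.fst ℂ V (Dual ℂ V)).dualMap f) (LinearMap.inr ℂ V (Dual ℂ V) g) = 0 := by
      simp
    rw [this, zero_smul, zero_sub]
    rfl
  conD_mulV v w := by
    refine LinearMap.ext fun x => ?_
    refine (CliffordAlgebra.contractLeft_ι_mul ..).trans ?_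
    have : (((LinearMap.snd ℂ V (Dual ℂ V)).dualMap ∘ₗ Dual.eval ℂ V) v)
        (LinearMap.inl ℂ V (Dual ℂ V) w) = 0 := by
      simp
    rw [this, zero_smul, zero_sub]
    rfl
  conD_mulD v f := by refine LinearMap.ext fun x => ?_; exact CliffordAlgebra.contractLeft_ι_mul ..

variable {V}

lemma fermionRep_mulV (v : V) (x : Fermions V) :
    (fermionRep V).mulV v x = ExteriorAlgebra.ι ℂ (v, 0) * x := rfl

lemma fermionRep_mulD (f : Dual ℂ V) (x : Fermions V) :
    (fermionRep V).mulD f x = ExteriorAlgebra.ι ℂ (0, f) * x := rfl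

lemma fermionRep_conV_one (f : Dual ℂ V) : (fermionRep V).conV f 1 = 0 :=
  CliffordAlgebra.contractLeft_one ..

lemma fermionRep_conD_one (v : V) : (fermionRep V).conD v 1 = 0 :=
  CliffordAlgebra.contractLeft_one ..

lemma ι_eq_add (m : V × Dual ℂ V) : ExteriorAlgebra.ι ℂ m =
    ExteriorAlgebra.ι ℂ (m.1, 0) + ExteriorAlgebra.ι ℂ ((0, m.2) : V × Dual ℂ V) := by
  rw [← map_add]; simp

/-- Induction on elements of `∧(V ⊕ V*)`. -/
lemma fermions_induction {P : Fermions V → Prop} (one : P 1)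
    (smul : ∀ (c : ℂ) x, P x → P (c • x)) (add : ∀ x y, P x → P y → P (x + y))
    (mulV : ∀ v x, P x → P ((fermionRep V).mulV v x))
    (mulD : ∀ f x, P x → P ((fermionRep V).mulD f x)) (x : Fermions V) : P x := by
  induction x using CliffordAlgebra.left_induction with
  | algebraMap r => rw [Algebra.algebraMap_eq_smul_one]; exact smul r 1 one
  | add x y hx hy => exact add x y hx hy
  | ι_mul x m hx =>
    have : ExteriorAlgebra.ι ℂ m * x =
        (fermionRep V).mulV m.1 x + (fermionRep V).mulD m.2 x := by
      rw [fermionRep_mulV, fermionRep_mulD, ← add_mul, ← ι_eq_add]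
    exact this ▸ add _ _ (mulV _ _ hx) (mulD _ _ hx)

variable (V) in
/-- The space of generators in bidegree `(1, 0)`. -/
abbrev genV : Submodule ℂ (Fermions V) :=
  LinearMap.range (ExteriorAlgebra.ι ℂ ∘ₗ LinearMap.inl ℂ V (Dual ℂ V))

variable (V) in
/-- The space of generators in bidegree `(0, 1)`. -/
abbrev genD : Submodule ℂ (Fermions V) :=
  LinearMap.range (ExteriorAlgebra.ι ℂ ∘ₗ LinearMap.inr ℂ V (Dual ℂ V))

lemma fermionPiece_succ_left (i j : ℕ) :
    fermionPiece V (i + 1) j = genV V * fermionPiece V i j := by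
  rw [fermionPiece, pow_succ', mul_assoc]; rfl

lemma fermionPiece_zero_succ (j : ℕ) :
    fermionPiece V 0 (j + 1) = genD V * fermionPiece V 0 j := by
  rw [fermionPiece, pow_succ', pow_zero, one_mul]
  rw [fermionPiece, pow_zero, one_mul]

lemma mulV_mem_fermionPiece {i j : ℕ} {x : Fermions V} (hx : x ∈ fermionPiece V i j) (v : V) :
    (fermionRep V).mulV v x ∈ fermionPiece V (i + 1) j := by
  rw [fermionPiece_succ_left, fermionRep_mulV]
  exact Submodule.mul_mem_mul ⟨v, rfl⟩ hx

/-- `fermionPiece` puts vectors before covectors; moving a new covector past the vectors costs only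
signs. -/
lemma mulD_mem_fermionPiece {i j : ℕ} {x : Fermions V} (hx : x ∈ fermionPiece V i j)
    (f : Dual ℂ V) : (fermionRep V).mulD f x ∈ fermionPiece V i (j + 1) := by
  induction i generalizing x with
  | zero =>
    rw [fermionPiece_zero_succ, fermionRep_mulD]
    exact Submodule.mul_mem_mul ⟨f, rfl⟩ hx
  | succ i ih =>
    rw [fermionPiece_succ_left] at hx
    refine Submodule.mul_induction_on hx ?_ ?_
    · rintro _ ⟨v, rfl⟩ y hy
      have : (fermionRep V).mulD f ((fermionRep V).mulV v y) =
          -((fermionRep V).mulV v ((fermionRep V).mulD f y)) :=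
        LinearMap.congr_fun ((fermionRep V).mulD_mulV v f) y
      change (fermionRep V).mulD f ((fermionRep V).mulV v y) ∈ _
      rw [this]
      exact Submodule.neg_mem _ (mulV_mem_fermionPiece (ih hy) v)
    · intro y z hy hz
      rw [map_add]
      exact Submodule.add_mem _ hy hz

lemma iSup_fermionPiece : ⨆ p : ℕ × ℕ, fermionPiece V p.1 p.2 = ⊤ := by
  rw [eq_top_iff]
  rintro x -
  induction x using fermions_induction with
  | one =>
    refine Submodule.mem_iSup_of_mem (0, 0) ?_
    rw [fermionPiece, pow_zero, pow_zero, one_mul]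
    exact Submodule.one_le.mp le_rfl
  | smul c x hx => exact Submodule.smul_mem _ _ hx
  | add x y hx hy => exact Submodule.add_mem _ hx hy
  | mulV v x hx =>
    induction hx using Submodule.iSup_induction' with
    | mem p x hx => exact Submodule.mem_iSup_of_mem (p.1 + 1, p.2) (mulV_mem_fermionPiece hx v)
    | zero => rw [map_zero]; exact zero_mem _
    | add x y _ _ hx hy => rw [map_add]; exact Submodule.add_mem _ hx hy
  | mulD f x hx =>
    induction hx using Submodule.iSup_induction' with
    | mem p x hx => exact Submodule.mem_iSup_of_mem (p.1, p.2 + 1) (mulD_mem_fermionPiece hx f)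
    | zero => rw [map_zero]; exact zero_mem _
    | add x y _ _ hx hy => rw [map_add]; exact Submodule.add_mem _ hx hy

variable {ι : Type*} [Fintype ι] (b : Basis ι ℂ V)

lemma mulV_mem_weight {p : ℤ × ℤ} {x : Fermions V} (hx : x ∈ (fermionRep V).weight b p) (v : V) :
    (fermionRep V).mulV v x ∈ (fermionRep V).weight b (p.1 + 1, p.2) := by
  rw [FermionRep.mem_weight] at *
  have h1 := LinearMap.congr_fun ((fermionRep V).numV_mul_mulV b v) x
  have h2 := LinearMap.congr_fun ((fermionRep V).numD_mul_mulV b v) x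
  simp only [End.mul_apply, LinearMap.add_apply, hx, map_smul] at h1 h2
  rw [h1, h2]
  push_cast
  constructor <;> module

lemma mulD_mem_weight {p : ℤ × ℤ} {x : Fermions V} (hx : x ∈ (fermionRep V).weight b p)
    (f : Dual ℂ V) : (fermionRep V).mulD f x ∈ (fermionRep V).weight b (p.1, p.2 + 1) := by
  rw [FermionRep.mem_weight] at *
  have h1 := LinearMap.congr_fun ((fermionRep V).numV_mul_mulD b f) x
  have h2 := LinearMap.congr_fun ((fermionRep V).numD_mul_mulD b f) x
  simp only [End.mul_apply, LinearMap.add_apply, hx, map_smul] at h1 h2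
  rw [h1, h2]
  push_cast
  constructor <;> module

lemma one_mem_weight : (1 : Fermions V) ∈ (fermionRep V).weight b (0, 0) := by
  rw [FermionRep.mem_weight]
  simp [FermionRep.numV, FermionRep.numD, fermionRep_conV_one, fermionRep_conD_one]

lemma fermionPiece_le_weight (i j : ℕ) :
    fermionPiece V i j ≤ (fermionRep V).weight b (i, j) := by
  induction i with
  | zero =>
    induction j with
    | zero =>
      rw [fermionPiece, pow_zero, pow_zero, one_mul]
      exact Submodule.one_le.mpr (one_mem_weight b)
    | succ j ih =>
      rw [fermionPiece_zero_succ]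
      refine Submodule.mul_le.mpr ?_
      rintro _ ⟨f, rfl⟩ y hy
      have := mulD_mem_weight b (ih hy) f
      push_cast at this ⊢
      exact this
  | succ i ih =>
    rw [fermionPiece_succ_left]
    refine Submodule.mul_le.mpr ?_
    rintro _ ⟨v, rfl⟩ y hy
    have := mulV_mem_weight b (ih hy) v
    push_cast at this ⊢
    exact this

variable (V) in
/-- The bigrading of `∧(V ⊕ V*)` extended by zero to `ℤ × ℤ`. -/
def intPiece (p : ℤ × ℤ) : Submodule ℂ (Fermions V) :=
  if 0 ≤ p.1 ∧ 0 ≤ p.2 then fermionPiece V p.1.toNat p.2.toNat else ⊥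

lemma intPiece_natCast (i j : ℕ) : intPiece V (i, j) = fermionPiece V i j := by
  simp [intPiece]

lemma intPiece_le_weight (p : ℤ × ℤ) : intPiece V p ≤ (fermionRep V).weight b p := by
  by_cases h : 0 ≤ p.1 ∧ 0 ≤ p.2
  · obtain ⟨i, hi⟩ := Int.eq_ofNat_of_zero_le h.1
    obtain ⟨j, hj⟩ := Int.eq_ofNat_of_zero_le h.2
    obtain rfl : p = (↑i, ↑j) := Prod.ext hi hj
    rw [intPiece_natCast]
    exact fermionPiece_le_weight b i j
  · rw [intPiece, if_neg h]; exact bot_le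

lemma iSup_intPiece : ⨆ p, intPiece V p = ⊤ := by
  rw [eq_top_iff, ← iSup_fermionPiece]
  exact iSup_le fun p => (intPiece_natCast (V := V) p.1 p.2) ▸ le_iSup (intPiece V) _

lemma iSup_weight : ⨆ p, (fermionRep V).weight b p = ⊤ :=
  eq_top_iff.mpr (iSup_intPiece.symm.le.trans (iSup_mono (intPiece_le_weight b)))

/-- The bigraded pieces span and sit inside independent weight spaces, hence fill them. -/
lemma weight_eq_intPiece (p : ℤ × ℤ) : (fermionRep V).weight b p = intPiece V p := by
  have := inf_iSup_eq_of_iSupIndep ((fermionRep V).weight_iSupIndep b) (intPiece_le_weight b) p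
  rwa [iSup_intPiece, inf_top_eq] at this

lemma weight_natCast (i j : ℕ) : (fermionRep V).weight b (i, j) = fermionPiece V i j := by
  rw [weight_eq_intPiece, intPiece_natCast]

lemma weight_eq_bot_of_neg {p : ℤ × ℤ} (hp : p.1 < 0 ∨ p.2 < 0) :
    (fermionRep V).weight b p = ⊥ := by
  rw [weight_eq_intPiece, intPiece, if_neg (by omega)]

section Finite

variable [FiniteDimensional ℂ V]

instance : FiniteDimensional ℂ (Fermions V) :=
  Module.Finite.of_basis (finBasis ℂ (V × Dual ℂ V)).ExteriorAlgebra

lemma finrank_fermions : finrank ℂ (Fermions V) = 2 ^ finrank ℂ V * 2 ^ finrank ℂ V := by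
  rw [finrank_eq_card_basis (finBasis ℂ (V × Dual ℂ V)).ExteriorAlgebra, Fintype.card_finset,
    Fintype.card_fin, finrank_prod, Subspace.dual_finrank_eq, pow_add]

lemma finrank_genV_pow_le (i : ℕ) :
    finrank ℂ (genV V ^ i : Submodule ℂ (Fermions V)) ≤ (finrank ℂ V).choose i := by
  have : genV V ^ i = (⋀[ℂ]^i V).map
      (ExteriorAlgebra.map (LinearMap.inl ℂ V (Dual ℂ V))).toLinearMap := by
    rw [Submodule.map_pow, ExteriorAlgebra.ι_range_map_map, ← LinearMap.range_comp]
  rw [this, ← exteriorPower.finrank_eq ℂ]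
  exact Submodule.finrank_map_le _ _

lemma finrank_genD_pow_le (i : ℕ) :
    finrank ℂ (genD V ^ i : Submodule ℂ (Fermions V)) ≤ (finrank ℂ V).choose i := by
  have : genD V ^ i = (⋀[ℂ]^i (Dual ℂ V)).map
      (ExteriorAlgebra.map (LinearMap.inr ℂ V (Dual ℂ V))).toLinearMap := by
    rw [Submodule.map_pow, ExteriorAlgebra.ι_range_map_map, ← LinearMap.range_comp]
  rw [this, ← Subspace.dual_finrank_eq (K := ℂ) (V := V), ← exteriorPower.finrank_eq ℂ]
  exact Submodule.finrank_map_le _ _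

lemma finrank_fermionPiece_le (i j : ℕ) :
    finrank ℂ (fermionPiece V i j) ≤ (finrank ℂ V).choose i * (finrank ℂ V).choose j :=
  (finrank_submodule_mul_le _ _).trans
    (Nat.mul_le_mul (finrank_genV_pow_le i) (finrank_genD_pow_le j))

lemma fermionPiece_eq_bot {i j : ℕ} (h : finrank ℂ V < i ∨ finrank ℂ V < j) :
    fermionPiece V i j = ⊥ := by
  rw [← Submodule.finrank_eq_zero (R := ℂ)]
  refine Nat.le_zero.mp ((finrank_fermionPiece_le i j).trans ?_)
  rcases h with h | h <;> simp [Nat.choose_eq_zero_of_lt h]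

lemma weight_eq_bot_of_lt {p : ℤ × ℤ} (hp : finrank ℂ V < p.1 ∨ finrank ℂ V < p.2) :
    (fermionRep V).weight b p = ⊥ := by
  rw [weight_eq_intPiece, intPiece]
  split_ifs with h
  · exact fermionPiece_eq_bot (by omega)
  · rfl

/-- Only upper bounds are proved directly. They sum to `2^n * 2^n`, the full dimension of `∧(V ⊕
V*)`, so every one of them is sharp. -/
theorem finrank_fermionPiece (i j : ℕ) :
    finrank ℂ (fermionPiece V i j) = (finrank ℂ V).choose i * (finrank ℂ V).choose j := by
  by_cases hij : finrank ℂ V < i ∨ finrank ℂ V < j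
  · rw [fermionPiece_eq_bot hij, finrank_bot]
    rcases hij with h | h <;> simp [Nat.choose_eq_zero_of_lt h]
  set n := finrank ℂ V with hn
  have htop : ⨆ p : Fin (n + 1) × Fin (n + 1), fermionPiece V p.1 p.2 = ⊤ := by
    rw [eq_top_iff, ← iSup_fermionPiece]
    refine iSup_le fun p => ?_
    by_cases hp : n < p.1 ∨ n < p.2
    · rw [fermionPiece_eq_bot hp]; exact bot_le
    · push Not at hp
      exact le_iSup (fun p : Fin (n + 1) × Fin (n + 1) => fermionPiece V p.1 p.2)
        (⟨p.1, by omega⟩, ⟨p.2, by omega⟩)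
  have h1 := finrank_le_sum_of_iSup_eq_top _ htop
  have h2 : ∑ p : Fin (n + 1) × Fin (n + 1), n.choose p.1 * n.choose p.2 = 2 ^ n * 2 ^ n := by
    rw [Fintype.sum_prod_type, ← Nat.sum_range_choose, ← Fin.sum_univ_eq_sum_range,
      Finset.sum_mul_sum]
  rw [finrank_fermions, ← hn, ← h2] at h1
  have h3 := (Finset.sum_eq_sum_iff_of_le
    (fun (p : Fin (n + 1) × Fin (n + 1)) _ => finrank_fermionPiece_le (V := V) p.1 p.2)).mp
    (le_antisymm (Finset.sum_le_sum fun p _ => finrank_fermionPiece_le (V := V) p.1 p.2) h1)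
  push Not at hij
  exact h3 (⟨i, by omega⟩, ⟨j, by omega⟩) (Finset.mem_univ _)

end Finite

end Concrete

/-! ### Roots of reflections and irreducibility of the action -/

section Reflections

variable {V : Type*} [AddCommGroup V] [Module ℂ V]

lemma isReflection_of_apply_eq [FiniteDimensional ℂ V]
    {t : V ≃ₗ[ℂ] V} {α : V} {f : Dual ℂ V} (hα : α ≠ 0) (hf : f ≠ 0)
    (ht : ∀ v, t v = v - f v • α) : IsReflection t := by
  have : fixedSpace t = LinearMap.ker f := by
    ext v
    simp [fixedSpace, ht, hα]
  rw [IsReflection, this]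
  exact Dual.finrank_ker_add_one_of_ne_zero hf

/-- A reflection of finite order is of the form `1 - f ⊗ α` with `f α ≠ 0`. -/
lemma IsReflection.exists_root [FiniteDimensional ℂ V]
    {t : V ≃ₗ[ℂ] V} (ht : IsReflection t) (hfin : IsOfFinOrder t) :
    ∃ (α : V) (f : Dual ℂ V), f α ≠ 0 ∧ ∀ v, t v = v - f v • α := by
  set d : V →ₗ[ℂ] V := LinearMap.id - (t : V →ₗ[ℂ] V) with hd
  have hker : fixedSpace t = LinearMap.ker d := by
    ext v
    simp [fixedSpace, hd, sub_eq_zero, eq_comm (a := v)]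
  have hrank : finrank ℂ (LinearMap.range d) = 1 := by
    have h1 := LinearMap.finrank_range_add_finrank_ker d
    rw [IsReflection, hker] at ht
    omega
  obtain ⟨⟨α, hαr⟩, hα0, hspan⟩ := finrank_eq_one_iff'.mp hrank
  have hα : α ≠ 0 := fun h => hα0 (Subtype.ext h)
  have hex : ∀ v, ∃ c : ℂ, c • α = d v := fun v => by
    obtain ⟨c, hc⟩ := hspan ⟨d v, LinearMap.mem_range_self d v⟩
    exact ⟨c, congrArg Subtype.val hc⟩
  choose c hc using hex
  let f : Dual ℂ V :=
    { toFun := c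
      map_add' := fun v w => smul_left_injective ℂ hα (by
        simp only [add_smul, hc, map_add])
      map_smul' := fun r v => smul_left_injective ℂ hα (by
        simp only [smul_assoc, hc, map_smul, RingHom.id_apply]) }
  have htf : ∀ v, t v = v - f v • α := fun v => by
    change t v = v - c v • α
    rw [hc, hd]; simp
  refine ⟨α, f, fun hfα => ?_, htf⟩
  -- If `f α = 0` then `t` is a transvection and `t ^ k` moves `v` by `k * f v`; finite order in
  -- characteristic zero forces `f = 0`.
  obtain ⟨m, hm, htm⟩ := isOfFinOrder_iff_pow_eq_one.mp hfin
  have hpow : ∀ (k : ℕ) (v : V), (t ^ k) v = v - (k * f v) • α := by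
    intro k
    induction k with
    | zero => intro v; simp
    | succ k ih =>
      intro v
      rw [pow_succ', LinearEquiv.mul_apply, ih, htf]
      simp only [map_sub, map_smul, hfα, smul_zero]
      push_cast
      module
  have hf0 : ∀ v, f v = 0 := fun v => by
    have h1 := hpow m v
    rw [htm, LinearEquiv.coe_one, id, eq_comm, sub_eq_self, smul_eq_zero] at h1
    simpa [hm.ne', hα] using h1
  obtain ⟨v, hv⟩ := hαr
  apply hα
  rw [← hv, ← hc v]
  change f v • α = 0
  rw [hf0, zero_smul]

/-! ### Irreducibility -/

section Block

variable {U U' : Submodule ℂ V} (h : IsCompl U U')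

/-- Block-diagonal automorphisms with respect to a decomposition `V = U ⊕ U'`. -/
def blockDiag : (U ≃ₗ[ℂ] U) × (U' ≃ₗ[ℂ] U') →* (V ≃ₗ[ℂ] V) where
  toFun w := (Submodule.prodEquivOfIsCompl U U' h).symm ≪≫ₗ (w.1.prodCongr w.2) ≪≫ₗ
    Submodule.prodEquivOfIsCompl U U' h
  map_one' := by
    ext v
    exact (Submodule.prodEquivOfIsCompl U U' h).apply_symm_apply v
  map_mul' w w' := by
    ext v
    simp [LinearEquiv.mul_apply]

lemma blockDiag_left (w : (U ≃ₗ[ℂ] U) × (U' ≃ₗ[ℂ] U')) (u : U) :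
    blockDiag h w (u : V) = w.1 u := by
  simp [blockDiag]

lemma blockDiag_right (w : (U ≃ₗ[ℂ] U) × (U' ≃ₗ[ℂ] U')) (u : U') :
    blockDiag h w (u : V) = w.2 u := by
  simp [blockDiag]

lemma eq_blockDiag {g : V ≃ₗ[ℂ] V} {w : (U ≃ₗ[ℂ] U) × (U' ≃ₗ[ℂ] U')}
    (h1 : ∀ u : U, g (u : V) = w.1 u) (h2 : ∀ u : U', g (u : V) = w.2 u) : g = blockDiag h w := by
  ext v
  obtain ⟨u, hu, u', hu', rfl⟩ := Submodule.mem_sup.mp (h.sup_eq_top ▸ Submodule.mem_top : v ∈ U ⊔ U')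
  rw [map_add, map_add, h1 ⟨u, hu⟩, h2 ⟨u', hu'⟩, blockDiag_left h w ⟨u, hu⟩,
    blockDiag_right h w ⟨u', hu'⟩]

lemma blockDiag_injective : Function.Injective (blockDiag h) := by
  intro w w' hw
  refine Prod.ext (LinearEquiv.ext fun u => Subtype.ext ?_)
    (LinearEquiv.ext fun u => Subtype.ext ?_)
  · rw [← blockDiag_left h, hw, blockDiag_left]
  · rw [← blockDiag_right h, hw, blockDiag_right]

end Block

/-- The restriction of an automorphism to a stable subspace. -/
def restrictEquiv (g : V ≃ₗ[ℂ] V) (U : Submodule ℂ V) (h1 : ∀ u ∈ U, g u ∈ U)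
    (h2 : ∀ u ∈ U, g.symm u ∈ U) : U ≃ₗ[ℂ] U :=
  LinearEquiv.ofLinearMap ((g : V →ₗ[ℂ] V).restrict h1) ((g.symm : V →ₗ[ℂ] V).restrict h2)
    (by ext u; simp) (by ext u; simp)

/-- Maschke's theorem for `W`, read off from semisimplicity of its representation on `V`. -/
lemma exists_isCompl_stable (W : Subgroup (V ≃ₗ[ℂ] V)) [Finite W] (U : Submodule ℂ V)
    (hU : ∀ g ∈ W, ∀ u ∈ U, g u ∈ U) :
    ∃ U' : Submodule ℂ V, IsCompl U U' ∧ ∀ g ∈ W, ∀ u ∈ U', g u ∈ U' := by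
  let ρ : Representation ℂ W V :=
    { toFun := fun g => ((g : V ≃ₗ[ℂ] V) : V →ₗ[ℂ] V)
      map_one' := rfl
      map_mul' := fun _ _ => rfl }
  have : NeZero (Nat.card W : ℂ) := ⟨by exact_mod_cast Nat.card_pos.ne'⟩
  have hss : ρ.IsSemisimpleRepresentation := inferInstance
  obtain ⟨q, hq⟩ := hss.exists_isCompl ⟨U, fun g u hu => hU g g.2 u hu⟩
  refine ⟨q.toSubmodule, ⟨?_, ?_⟩, fun g hg u hu => q.apply_mem_toSubmodule ⟨g, hg⟩ hu⟩
  · rw [disjoint_iff]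
    exact congrArg Subrepresentation.toSubmodule (disjoint_iff.mp hq.disjoint)
  · rw [codisjoint_iff]
    exact congrArg Subrepresentation.toSubmodule (codisjoint_iff.mp hq.codisjoint)

/-- The pairs `(α, f)` such that `1 - f ⊗ α` is a semisimple reflection of `W`. -/
def rootPairs (W : Subgroup (V ≃ₗ[ℂ] V)) : Set (V × Dual ℂ V) :=
  {p | p.2 p.1 ≠ 0 ∧ ∃ t ∈ W, ∀ v, t v = v - p.2 v • p.1}

variable {W : Subgroup (V ≃ₗ[ℂ] V)}

lemma IsComplexReflectionGroup.exists_rootPair [FiniteDimensional ℂ V]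
    (hW : IsComplexReflectionGroup W)
    {t : V ≃ₗ[ℂ] V} (htW : t ∈ W) (ht : IsReflection t) :
    ∃ p ∈ rootPairs W, ∀ v, t v = v - p.2 v • p.1 := by
  have := hW.1
  have hfin : IsOfFinOrder t := by
    exact W.subtype.isOfFinOrder (isOfFinOrder_of_finite (⟨t, htW⟩ : W))
  obtain ⟨α, f, h0, h⟩ := ht.exists_root hfin
  exact ⟨(α, f), ⟨h0, t, htW, h⟩, h⟩

/-- A subspace compatible with all reflections is stable. -/
lemma IsComplexReflectionGroup.stable [FiniteDimensional ℂ V]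
    (hW : IsComplexReflectionGroup W) {U : Submodule ℂ V}
    (hU : ∀ p ∈ rootPairs W, p.1 ∈ U ∨ U ≤ LinearMap.ker p.2) :
    ∀ g ∈ W, ∀ u ∈ U, g u ∈ U := by
  -- Equality rather than inclusion, so that the closure induction passes to inverses.
  have key : ∀ g ∈ W, U.map (g : V →ₗ[ℂ] V) = U := by
    rw [← hW.2]
    intro g hg
    induction hg using Subgroup.closure_induction with
    | mem t ht =>
      obtain ⟨p, hp, htp⟩ := hW.exists_rootPair ht.1 ht.2
      have hle : U.map (t : V →ₗ[ℂ] V) ≤ U := by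
        rintro _ ⟨u, hu, rfl⟩
        rw [LinearEquiv.coe_coe, htp]
        rcases hU p hp with h | h
        · exact Submodule.sub_mem _ hu (Submodule.smul_mem _ _ h)
        · rw [LinearMap.mem_ker.mp (h hu), zero_smul, sub_zero]; exact hu
      exact Submodule.eq_of_le_of_finrank_eq hle (LinearEquiv.finrank_map_eq t U)
    | one => exact Submodule.map_id U
    | mul g g' _ _ h h' =>
      have : ((g * g' : V ≃ₗ[ℂ] V) : V →ₗ[ℂ] V) = (g : V →ₗ[ℂ] V) ∘ₗ (g' : V →ₗ[ℂ] V) := rfl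
      rw [this, Submodule.map_comp, h', h]
    | inv g _ h =>
      conv_lhs => rw [← h]
      rw [← Submodule.map_comp]
      have : ((g⁻¹ : V ≃ₗ[ℂ] V) : V →ₗ[ℂ] V) ∘ₗ (g : V →ₗ[ℂ] V) = LinearMap.id :=
        LinearMap.ext fun v => g.symm_apply_apply v
      rw [this, Submodule.map_id]
  intro g hg u hu
  exact (key g hg).le ⟨u, hu, rfl⟩

/-- The dichotomy for a reflection preserving both summands of `V`. -/
lemma root_mem_or {U U' : Submodule ℂ V} (h : IsCompl U U') {t : V ≃ₗ[ℂ] V} {α : V}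
    {f : Dual ℂ V} (hα : f α ≠ 0) (ht : ∀ v, t v = v - f v • α) (hU : ∀ u ∈ U, t u ∈ U)
    (hU' : ∀ u ∈ U', t u ∈ U') :
    (α ∈ U ∧ U' ≤ LinearMap.ker f) ∨ (α ∈ U' ∧ U ≤ LinearMap.ker f) := by
  have aux : ∀ X : Submodule ℂ V, (∀ u ∈ X, t u ∈ X) → α ∈ X ∨ X ≤ LinearMap.ker f := by
    intro X hX
    by_cases hk : X ≤ LinearMap.ker f
    · exact Or.inr hk
    · obtain ⟨u, hu, hfu⟩ := SetLike.not_le_iff_exists.mp hk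
      left
      have h1 : f u • α ∈ X := by
        have := X.sub_mem hu (hX u hu)
        rwa [ht, sub_sub_cancel] at this
      exact (Submodule.smul_mem_iff _ hfu).mp h1
  have hα0 : α ≠ 0 := fun h => hα (by rw [h, map_zero])
  have hf : ¬(U ≤ LinearMap.ker f ∧ U' ≤ LinearMap.ker f) := by
    rintro ⟨h1, h2⟩
    have : α ∈ U ⊔ U' := h.sup_eq_top ▸ Submodule.mem_top
    exact hα (LinearMap.mem_ker.mp (sup_le h1 h2 this))
  have hd : ¬(α ∈ U ∧ α ∈ U') := fun h1 =>
    hα0 (Submodule.disjoint_def.mp h.disjoint α h1.1 h1.2)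
  rcases aux U hU with h1 | h1 <;> rcases aux U' hU' with h2 | h2
  · exact absurd ⟨h1, h2⟩ hd
  · exact Or.inl ⟨h1, h2⟩
  · exact Or.inr ⟨h2, h1⟩
  · exact absurd ⟨h1, h2⟩ hf

/-- A group preserving `V = U ⊕ U'` is a product of reflection groups. -/
lemma exists_isProductAction [FiniteDimensional ℂ V]
    (hW : IsComplexReflectionGroup W) {U U' : Submodule ℂ V}
    (h : IsCompl U U') (hU : ∀ g ∈ W, ∀ u ∈ U, g u ∈ U) (hU' : ∀ g ∈ W, ∀ u ∈ U', g u ∈ U') :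
    ∃ (W₁ : Subgroup (U ≃ₗ[ℂ] U)) (W₂ : Subgroup (U' ≃ₗ[ℂ] U')),
      IsComplexReflectionGroup W₁ ∧ IsComplexReflectionGroup W₂ ∧ IsProductAction W W₁ W₂ := by
  have := hW.1
  let j₁ := (blockDiag h).comp (MonoidHom.inl _ _)
  let j₂ := (blockDiag h).comp (MonoidHom.inr _ _)
  have hj₁ : Function.Injective j₁ := (blockDiag_injective h).comp fun a a' h => congrArg Prod.fst h
  have hj₂ : Function.Injective j₂ := (blockDiag_injective h).comp fun a a' h => congrArg Prod.snd h
  let W₁ := W.comap j₁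
  let W₂ := W.comap j₂
  let C₁ := Subgroup.closure {t | t ∈ W₁ ∧ IsReflection t}
  let C₂ := Subgroup.closure {t | t ∈ W₂ ∧ IsReflection t}
  have hC₁ : C₁ ≤ W₁ := (Subgroup.closure_le _).mpr fun t ht => ht.1
  have hC₂ : C₂ ≤ W₂ := (Subgroup.closure_le _).mpr fun t ht => ht.1
  have hsymm : ∀ g ∈ W, g.symm ∈ W := fun g hg => W.inv_mem hg
  -- Each reflection of `W` is nontrivial on one summand only, hence lies in one factor. This one
  -- inclusion gives both the product decomposition and the equalities `C₁ = W₁`, `C₂ = W₂`.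
  have key : W ≤ (C₁.prod C₂).map (blockDiag h) := by
    conv_lhs => rw [← hW.2]
    rw [Subgroup.closure_le]
    rintro t ⟨htW, ht⟩
    obtain ⟨⟨α, f⟩, ⟨h0, -⟩, htp⟩ := hW.exists_rootPair htW ht
    simp only at h0 htp
    have hα0 : α ≠ 0 := fun h => h0 (by rw [h, map_zero])
    rcases root_mem_or h h0 htp (hU t htW) (hU' t htW) with ⟨h1, h2⟩ | ⟨h1, h2⟩
    · let w := restrictEquiv t U (hU t htW) (hU _ (hsymm t htW))
      have hb : t = blockDiag h (w, 1) := eq_blockDiag h (fun u => rfl) fun u => by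
        rw [htp, LinearMap.mem_ker.mp (h2 u.2), zero_smul, sub_zero]; rfl
      refine ⟨(w, 1), ⟨Subgroup.subset_closure ⟨?_, ?_⟩, one_mem _⟩, hb.symm⟩
      · exact (hb ▸ htW : blockDiag h (w, 1) ∈ W)
      · refine isReflection_of_apply_eq (α := ⟨α, h1⟩) (f := f.comp U.subtype)
          (fun h => hα0 (congrArg Subtype.val h))
          (fun h => h0 (LinearMap.congr_fun h ⟨α, h1⟩)) fun u => Subtype.ext (htp u)
    · let w := restrictEquiv t U' (hU' t htW) (hU' _ (hsymm t htW))
      have hb : t = blockDiag h (1, w) := eq_blockDiag h (fun u => by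
        rw [htp, LinearMap.mem_ker.mp (h2 u.2), zero_smul, sub_zero]; rfl) fun u => rfl
      refine ⟨(1, w), ⟨one_mem _, Subgroup.subset_closure ⟨?_, ?_⟩⟩, hb.symm⟩
      · exact (hb ▸ htW : blockDiag h (1, w) ∈ W)
      · refine isReflection_of_apply_eq (α := ⟨α, h1⟩) (f := f.comp U'.subtype)
          (fun h => hα0 (congrArg Subtype.val h))
          (fun h => h0 (LinearMap.congr_fun h ⟨α, h1⟩)) fun u => Subtype.ext (htp u)
  refine ⟨W₁, W₂, ⟨?_, ?_⟩, ⟨?_, ?_⟩, ?_⟩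
  · exact Finite.of_injective (fun w : W₁ => (⟨j₁ w, w.2⟩ : W)) fun w w' hw =>
      Subtype.ext (hj₁ (congrArg Subtype.val hw))
  · refine le_antisymm hC₁ fun w hw => ?_
    obtain ⟨⟨a, c⟩, ⟨ha, -⟩, hac⟩ := key hw
    rw [show w = a from (congrArg Prod.fst (blockDiag_injective h hac)).symm]
    exact ha
  · exact Finite.of_injective (fun w : W₂ => (⟨j₂ w, w.2⟩ : W)) fun w w' hw =>
      Subtype.ext (hj₂ (congrArg Subtype.val hw))
  · refine le_antisymm hC₂ fun w hw => ?_
    obtain ⟨⟨a, c⟩, ⟨-, hc⟩, hac⟩ := key hw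
    rw [show w = c from (congrArg Prod.snd (blockDiag_injective h hac)).symm]
    exact hc
  · intro g
    constructor
    · intro hg
      obtain ⟨⟨a, c⟩, ⟨ha, hc⟩, rfl⟩ := key hg
      exact ⟨a, hC₁ ha, c, hC₂ hc, blockDiag_left h (a, c), blockDiag_right h (a, c)⟩
    · rintro ⟨w₁, hw₁, w₂, hw₂, e₁, e₂⟩
      have : g = j₁ w₁ * j₂ w₂ := by
        rw [eq_blockDiag h (w := (w₁, w₂)) e₁ e₂]
        simp only [j₁, j₂, MonoidHom.comp_apply, ← map_mul, MonoidHom.inl_apply,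
          MonoidHom.inr_apply, Prod.mk_mul_mk, mul_one, one_mul]
      rw [this]
      exact W.mul_mem hw₁ hw₂

/-- An irreducible reflection group acts irreducibly. -/
theorem IsIrreducibleReflectionGroup.eq_bot_or_eq_top [FiniteDimensional ℂ V]
    (hW : IsIrreducibleReflectionGroup W)
    {U : Submodule ℂ V} (hU : ∀ p ∈ rootPairs W, p.1 ∈ U ∨ U ≤ LinearMap.ker p.2) :
    U = ⊥ ∨ U = ⊤ := by
  have := hW.1.1
  have hst := hW.1.stable hU
  obtain ⟨U', hc, hst'⟩ := exists_isCompl_stable W U hst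
  refine (hW.2 U U' hc (exists_isProductAction hW.1 hc hst hst')).imp id fun h => ?_
  rw [h] at hc
  simpa using hc.sup_eq_top

/-- Without roots every subspace passes the irreducibility test, so `V` is a line, and `W`,
generated by no reflections, is trivial. -/
lemma IsIrreducibleReflectionGroup.rootPairs_nonempty [FiniteDimensional ℂ V]
    (hW : IsIrreducibleReflectionGroup W)
    (h0 : finrank ℂ V ≠ 0) (h1 : finrank ℂ V = 1 → W ≠ ⊥) : (rootPairs W).Nonempty := by
  by_contra hne
  rw [Set.not_nonempty_iff_eq_empty] at hne
  have hirr : ∀ U : Submodule ℂ V, U = ⊥ ∨ U = ⊤ := fun U =>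
    hW.eq_bot_or_eq_top fun p hp => by rw [hne] at hp; exact hp.elim
  have : Nontrivial V := nontrivial_of_finrank_pos (Nat.pos_of_ne_zero h0)
  obtain ⟨v, hv⟩ := exists_ne (0 : V)
  have hdim : finrank ℂ V = 1 := by
    have htop : ℂ ∙ v = ⊤ := (hirr _).resolve_left (by simpa using hv)
    rw [← finrank_top ℂ V, ← htop, finrank_span_singleton hv]
  refine h1 hdim ?_
  rw [← hW.1.2, Subgroup.closure_eq_bot_iff]
  rintro t ⟨htW, ht⟩
  obtain ⟨p, hp, -⟩ := hW.1.exists_rootPair htW ht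
  rw [hne] at hp
  exact hp.elim

end Reflections

/-! ### The action on fermions -/

section Action

variable {V : Type*} [AddCommGroup V] [Module ℂ V]

lemma act_mulV (g : V ≃ₗ[ℂ] V) (v : V) (x : Fermions V) :
    act g ((fermionRep V).mulV v x) = (fermionRep V).mulV (g v) (act g x) := by
  rw [fermionRep_mulV, fermionRep_mulV, map_mul, act, ExteriorAlgebra.map_apply_ι]
  simp [actLinear]

lemma act_mulD (g : V ≃ₗ[ℂ] V) (f : Dual ℂ V) (x : Fermions V) :
    act g ((fermionRep V).mulD f x) =
      (fermionRep V).mulD (f ∘ₗ (g.symm : V →ₗ[ℂ] V)) (act g x) := by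
  rw [fermionRep_mulD, fermionRep_mulD, map_mul, act, ExteriorAlgebra.map_apply_ι]
  congr 2
  simp only [actLinear, LinearMap.prodMap_apply, map_zero]
  rfl

/-- Both sides fix `1` and transform creation operators alike, and these generate `∧(V ⊕ V*)` from
`1`. The scalar `z` comes from the inverse `1 + z f ⊗ α` acting on covectors. -/
lemma act_eq_reflOp {t : V ≃ₗ[ℂ] V} {α : V} {f : Dual ℂ V} {z : ℂ} (hz : z * (1 - f α) = 1)
    (ht : ∀ v, t v = v - f v • α) (x : Fermions V) :
    act t x = (fermionRep V).reflOp α f z x := by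
  have hsymm : ∀ v, t.symm v = v + (z * f v) • α := fun v => by
    rw [LinearEquiv.symm_apply_eq, ht, map_add, map_smul, smul_eq_mul, add_sub_assoc, ← sub_smul,
      show z * f v - (f v + z * f v * f α) = f v * (z * (1 - f α) - 1) by ring, hz, sub_self,
      mul_zero, zero_smul, add_zero]
  induction x using fermions_induction with
  | one =>
    rw [map_one]
    simp [FermionRep.reflOp, fermionRep_conV_one, fermionRep_conD_one]
  | smul c x hx => rw [map_smul, map_smul, hx]
  | add x y hx hy => rw [map_add, map_add, hx, hy]
  | mulV v x hx =>
    rw [act_mulV, hx, ht]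
    exact (LinearMap.congr_fun ((fermionRep V).reflOp_mul_mulV α f z) x).symm
  | mulD g x hx =>
    rw [act_mulD, hx]
    have : g ∘ₗ (t.symm : V →ₗ[ℂ] V) = g + (z * g α) • f := by
      ext v
      simp [hsymm]
      ring
    rw [this]
    exact (LinearMap.congr_fun ((fermionRep V).reflOp_mul_mulD α f z) x).symm

/-- The invariants of an irreducible reflection group are killed by `𝔤𝔩(V)`. -/
theorem glAct_eq_zero_of_invariant [FiniteDimensional ℂ V] {W : Subgroup (V ≃ₗ[ℂ] V)}
    (hW : IsIrreducibleReflectionGroup W) (hntriv : finrank ℂ V = 1 → W ≠ ⊥) {x : Fermions V}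
    (hx : ∀ g ∈ W, act g x = x) (v : V) (f : Dual ℂ V) : (fermionRep V).glAct v f x = 0 := by
  by_cases h0 : finrank ℂ V = 0
  · have : Subsingleton V := finrank_zero_iff.mp h0
    rw [Subsingleton.elim v 0]
    simp [FermionRep.glAct]
  · refine (fermionRep V).glAct_eq_zero_of_roots (rootPairs W) (hW.rootPairs_nonempty h0 hntriv)
      (fun p hp => hp.1) (fun U hU => hW.eq_bot_or_eq_top hU) ?_ v f
    rintro ⟨α, f⟩ ⟨h1, t, htW, ht⟩
    simp only at h1 ht ⊢
    -- `1 - f α` is the eigenvalue of the invertible `t` on `α`.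
    have hz : 1 - f α ≠ 0 := by
      intro h
      have h2 : t α = 0 := by
        rw [ht, ← sub_eq_zero.mp h, one_smul, sub_self]
      rw [LinearEquiv.map_eq_zero_iff] at h2
      rw [h2, map_zero] at h1
      exact h1 rfl
    refine (fermionRep V).glAct_eq_zero_of_reflOp α f (inv_mul_cancel₀ hz) h1 ?_
    rw [← act_eq_reflOp (inv_mul_cancel₀ hz) ht]
    exact hx t htW

end Action

lemma mem_of_sum_mem_iSup {κ M : Type*} [AddCommGroup M] [Module ℂ M] {E G : κ → Submodule ℂ M}
    (hE : iSupIndep E) (hG : ∀ p, G p ≤ E p) {s : Finset κ} {x : κ → M} (hx : ∀ p ∈ s, x p ∈ E p)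
    (h : ∑ p ∈ s, x p ∈ ⨆ q, G q) : ∀ p ∈ s, x p ∈ G p := by
  classical
  intro p hp
  -- Enlarging `G` to `E` away from `p` absorbs the other summands and leaves a statement about `x
  -- p` alone.
  have hG' : ∀ q, Function.update E p (G p) q ≤ E q := fun q => by
    by_cases hq : q = p
    · subst hq; simpa using hG q
    · simp [hq]
  have key := inf_iSup_eq_of_iSupIndep hE hG' p
  rw [Function.update_self] at key
  rw [← key]
  refine ⟨hx p hp, ?_⟩
  rw [← Finset.add_sum_erase s x hp] at h
  have h1 : ∑ q ∈ s.erase p, x q ∈ ⨆ q, Function.update E p (G p) q :=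
    Submodule.sum_mem _ fun q hq => Submodule.mem_iSup_of_mem q (by
      rw [Function.update_of_ne (Finset.ne_of_mem_erase hq)]
      exact hx q (Finset.mem_of_mem_erase hq))
  have h2 : ⨆ q, G q ≤ ⨆ q, Function.update E p (G p) q := iSup_mono fun q => by
    by_cases hq : q = p
    · subst hq; simp
    · simpa [hq] using hG q
  exact (Submodule.add_mem_iff_left _ h1).mp (h2 h)

lemma finrank_map_add_finrank_inf_ker {M N : Type*} [AddCommGroup M] [Module ℂ M]
    [AddCommGroup N] [Module ℂ N] [FiniteDimensional ℂ M] (f : M →ₗ[ℂ] N) (p : Submodule ℂ M) :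
    finrank ℂ (p.map f) + finrank ℂ (p ⊓ LinearMap.ker f : Submodule ℂ M) = finrank ℂ p := by
  rw [← LinearMap.finrank_range_add_finrank_ker (f.domRestrict p), LinearMap.range_domRestrict,
    ← Submodule.map_comap_subtype, LinearEquiv.finrank_eq
      (Submodule.equivMapOfInjective p.subtype p.injective_subtype _).symm]
  rfl

/-! ### The coinvariant ideal and the dimensions of its quotient -/

section Coinvariants

variable {V : Type*} [AddCommGroup V] [Module ℂ V] {ι : Type*} [Fintype ι] (b : Basis ι ℂ V)

/-- The Casimir element `∑ θ_i ξ_i`. -/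
def casimirElt : Fermions V :=
  ∑ i, ExteriorAlgebra.ι ℂ (b i, (0 : Dual ℂ V)) * ExteriorAlgebra.ι ℂ ((0 : V), b.coord i)

lemma raise_apply (x : Fermions V) : (fermionRep V).raise b x = casimirElt b * x := by
  simp only [FermionRep.raise, LinearMap.sum_apply, End.mul_apply, fermionRep_mulV,
    fermionRep_mulD, casimirElt, Finset.sum_mul, mul_assoc]

lemma ι_mul_casimirElt_mul (m : V × Dual ℂ V) (x : Fermions V) :
    ExteriorAlgebra.ι ℂ m * (casimirElt b * x) = casimirElt b * (ExteriorAlgebra.ι ℂ m * x) := by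
  simp only [casimirElt, Finset.sum_mul, Finset.mul_sum, mul_assoc]
  refine Finset.sum_congr rfl fun i _ => ?_
  rw [ι_mul_ι_mul_swap m, ι_mul_ι_mul_swap m, mul_neg, neg_neg]

lemma mul_casimirElt (x : Fermions V) : x * casimirElt b = casimirElt b * x := by
  induction x using CliffordAlgebra.left_induction with
  | algebraMap r => exact Algebra.commutes r _
  | add x y hx hy => rw [add_mul, mul_add, hx, hy]
  | ι_mul x m hx => rw [mul_assoc, hx]; exact ι_mul_casimirElt_mul b m x

lemma algebraMapInv_casimirElt : ExteriorAlgebra.algebraMapInv (casimirElt b) = 0 := by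
  simp [casimirElt, ExteriorAlgebra.algebraMapInv]

lemma sum_ι_smul (v : V) :
    ∑ i, b.coord i v • ExteriorAlgebra.ι ℂ (b i, (0 : Dual ℂ V)) = ExteriorAlgebra.ι ℂ (v, 0) := by
  have h : ∀ w : V, ExteriorAlgebra.ι ℂ (w, (0 : Dual ℂ V)) =
      (ExteriorAlgebra.ι ℂ ∘ₗ LinearMap.inl ℂ V (Dual ℂ V)) w := fun w => rfl
  simp_rw [h, ← map_smul, ← map_sum, Basis.coord_apply, b.sum_repr]

lemma sum_ι_smul_coord (f : Dual ℂ V) :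
    ∑ i, f (b i) • ExteriorAlgebra.ι ℂ ((0 : V), b.coord i) = ExteriorAlgebra.ι ℂ (0, f) := by
  have h : ∀ g : Dual ℂ V, ExteriorAlgebra.ι ℂ ((0 : V), g) =
      (ExteriorAlgebra.ι ℂ ∘ₗ LinearMap.inr ℂ V (Dual ℂ V)) g := fun w => rfl
  simp_rw [h, ← map_smul, ← map_sum, b.sum_dual_apply_smul_coord]

/-- The Casimir element corresponds to the identity of `V ⊗ V*`: expanding `g (b i)` in the basis
transfers `g` to the covector, where it cancels `g⁻¹`. -/
lemma act_casimirElt (g : V ≃ₗ[ℂ] V) : act g (casimirElt b) = casimirElt b := by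
  have h1 : ∀ v : V, act g (ExteriorAlgebra.ι ℂ (v, 0)) = ExteriorAlgebra.ι ℂ (g v, 0) :=
    fun v => by
      rw [act, ExteriorAlgebra.map_apply_ι]; simp [actLinear]
  have h2 : ∀ f : Dual ℂ V, act g (ExteriorAlgebra.ι ℂ (0, f)) =
      ExteriorAlgebra.ι ℂ (0, f ∘ₗ (g.symm : V →ₗ[ℂ] V)) := fun f => by
    rw [act, ExteriorAlgebra.map_apply_ι]
    simp only [actLinear, LinearMap.prodMap_apply, map_zero]
    rfl
  calc act g (casimirElt b)
      = ∑ i, ∑ k, b.coord k (g (b i)) • (ExteriorAlgebra.ι ℂ (b k, (0 : Dual ℂ V)) *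
          ExteriorAlgebra.ι ℂ ((0 : V), b.coord i ∘ₗ (g.symm : V →ₗ[ℂ] V))) := by
        rw [casimirElt, map_sum]
        refine Finset.sum_congr rfl fun i _ => ?_
        rw [map_mul, h1, h2, ← sum_ι_smul b (g (b i)), Finset.sum_mul]
        simp only [smul_mul_assoc]
    _ = ∑ k, ExteriorAlgebra.ι ℂ (b k, (0 : Dual ℂ V)) *
          act g (ExteriorAlgebra.ι ℂ ((0 : V), b.coord k ∘ₗ (g : V →ₗ[ℂ] V))) := by
        rw [Finset.sum_comm]
        refine Finset.sum_congr rfl fun k _ => ?_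
        rw [← sum_ι_smul_coord b, map_sum, Finset.mul_sum]
        refine Finset.sum_congr rfl fun i _ => ?_
        rw [map_smul, h2, mul_smul_comm]
        rfl
    _ = casimirElt b := by
        rw [casimirElt]
        refine Finset.sum_congr rfl fun k _ => ?_
        rw [h2]
        congr 3
        ext v
        simp

lemma casimirElt_mem (W : Subgroup (V ≃ₗ[ℂ] V)) : casimirElt b ∈ positiveInvariants W :=
  ⟨fun g _ => act_casimirElt b g, algebraMapInv_casimirElt b⟩

/-- The weight components of the image of `raise`. -/
def raiseImage (p : ℤ × ℤ) : Submodule ℂ (Fermions V) :=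
  ((fermionRep V).weight b (p.1 - 1, p.2 - 1)).map ((fermionRep V).raise b)

lemma raiseImage_le (p : ℤ × ℤ) : raiseImage b p ≤ (fermionRep V).weight b p := by
  rintro _ ⟨x, hx, rfl⟩
  simpa using (fermionRep V).raise_mem_weight hx

lemma iSup_raiseImage : ⨆ p, raiseImage b p = LinearMap.range ((fermionRep V).raise b) := by
  have h : ⨆ p : ℤ × ℤ, (fermionRep V).weight b (p.1 - 1, p.2 - 1) = ⊤ := by
    rw [← iSup_weight b]
    exact ((Equiv.subRight (1 : ℤ)).prodCongr (Equiv.subRight (1 : ℤ))).iSup_comp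
      (g := (fermionRep V).weight b)
  simp only [raiseImage]
  rw [← Submodule.map_iSup, h, Submodule.map_top]

variable [FiniteDimensional ℂ V]

lemma positiveInvariants_subset {W : Subgroup (V ≃ₗ[ℂ] V)} (hW : IsIrreducibleReflectionGroup W)
    (hntriv : finrank ℂ V = 1 → W ≠ ⊥) {x : Fermions V} (hx : x ∈ positiveInvariants W) :
    ∃ y, x = casimirElt b * y := by
  have hgl := glAct_eq_zero_of_invariant hW hntriv hx.1
  have hmem := (fermionRep V).mem_sup_of_glAct_eq_zero (b := b) (iSup_weight b)
    (fun p hp => weight_eq_bot_of_lt b (Or.inl (by rwa [finrank_eq_card_basis b]))) hgl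
  obtain ⟨u, hu, z, ⟨y, rfl⟩, rfl⟩ := Submodule.mem_sup.mp hmem
  have h00 : (fermionRep V).weight b (0, 0) = 1 := by
    have := weight_natCast b 0 0
    rw [fermionPiece, pow_zero, pow_zero, one_mul] at this
    exact_mod_cast this
  -- Bidegree `(0, 0)` consists of constants, and the vanishing constant term removes this summand.
  rw [h00] at hu
  obtain ⟨c, rfl⟩ := Submodule.mem_one.mp hu
  have h0 := hx.2
  rw [map_add, raise_apply, map_mul, algebraMapInv_casimirElt, zero_mul, add_zero,
    ExteriorAlgebra.algebraMap_leftInverse] at h0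
  exact ⟨y, by rw [h0, map_zero, zero_add, raise_apply]⟩

/-- The coinvariant ideal is generated by the Casimir element. -/
theorem mem_coinvariantIdeal_iff {W : Subgroup (V ≃ₗ[ℂ] V)}
    (hW : IsIrreducibleReflectionGroup W) (hntriv : finrank ℂ V = 1 → W ≠ ⊥) {x : Fermions V} :
    x ∈ coinvariantIdeal W ↔ x ∈ LinearMap.range ((fermionRep V).raise b) := by
  rw [coinvariantIdeal, TwoSidedIdeal.mem_asIdeal]
  -- The image of `raise` is a two-sided ideal because the Casimir element is central.
  let J : TwoSidedIdeal (Fermions V) := TwoSidedIdeal.mk'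
    (LinearMap.range ((fermionRep V).raise b) : Set (Fermions V)) (zero_mem _)
    (fun hx hy => add_mem hx hy) (fun hx => neg_mem hx)
    (by
      rintro x _ ⟨y, rfl⟩
      refine ⟨x * y, ?_⟩
      rw [raise_apply, raise_apply, ← mul_assoc, ← mul_casimirElt, mul_assoc])
    (by
      rintro _ x ⟨y, rfl⟩
      refine ⟨y * x, ?_⟩
      rw [raise_apply, raise_apply, mul_assoc])
  have hJ : ∀ z, z ∈ J ↔ z ∈ LinearMap.range ((fermionRep V).raise b) := fun z =>
    TwoSidedIdeal.mem_mk' ..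
  constructor
  · intro hx
    rw [← hJ]
    refine (TwoSidedIdeal.mem_span_iff.mp hx) J fun z hz => ?_
    obtain ⟨y, rfl⟩ := positiveInvariants_subset b hW hntriv hz
    exact (hJ _).mpr ⟨y, raise_apply b y⟩
  · rintro ⟨y, rfl⟩
    rw [raise_apply]
    exact TwoSidedIdeal.mul_mem_right _ _ _ (TwoSidedIdeal.subset_span (casimirElt_mem b W))

lemma ker_mk {W : Subgroup (V ≃ₗ[ℂ] V)} (hW : IsIrreducibleReflectionGroup W)
    (hntriv : finrank ℂ V = 1 → W ≠ ⊥) :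
    LinearMap.ker (Ideal.Quotient.mkₐ ℂ (coinvariantIdeal W)).toLinearMap =
      LinearMap.range ((fermionRep V).raise b) := by
  ext x
  rw [← mem_coinvariantIdeal_iff b hW hntriv]
  exact Ideal.Quotient.eq_zero_iff_mem

variable {b}

/-- The ideal is the image of a bihomogeneous operator, hence a sum of its bigraded components, so
the bigrading descends to the quotient. -/
theorem drPiece_isInternal {W : Subgroup (V ≃ₗ[ℂ] V)} (hW : IsIrreducibleReflectionGroup W)
    (hntriv : finrank ℂ V = 1 → W ≠ ⊥) :
    DirectSum.IsInternal (fun p : ℕ × ℕ => drPiece W p.1 p.2) := by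
  have b := finBasis ℂ V
  refine DirectSum.isInternal_submodule_of_iSupIndep_of_iSup_eq_top ?_ ?_
  · rw [iSupIndep_iff_finsetSum_eq_zero_imp_eq_zero]
    intro s v hv hsum
    choose! x hx hxv using hv
    have hx' : ∀ p ∈ s, x p ∈ (fermionRep V).weight b (p.1, p.2) := fun p hp =>
      fermionPiece_le_weight b _ _ (hx p hp)
    have hinj : Function.Injective (fun p : ℕ × ℕ => ((p.1 : ℤ), (p.2 : ℤ))) := by
      rintro ⟨i, j⟩ ⟨k, l⟩ h
      simpa using h
    have hmem : ∑ p ∈ s, x p ∈ LinearMap.range ((fermionRep V).raise b) := by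
      rw [← ker_mk b hW hntriv, LinearMap.mem_ker, map_sum, ← hsum]
      exact Finset.sum_congr rfl hxv
    have hmem' : ∀ p ∈ s, x p ∈ raiseImage b (p.1, p.2) := by
      let s' := s.map ⟨_, hinj⟩
      let x' : ℤ × ℤ → Fermions V := fun q => x (q.1.toNat, q.2.toNat)
      have h1 : ∑ q ∈ s', x' q = ∑ p ∈ s, x p := by simp [s', x']
      rw [← iSup_raiseImage, ← h1] at hmem
      have h2 := mem_of_sum_mem_iSup ((fermionRep V).weight_iSupIndep b) (raiseImage_le b)
        (s := s') (x := x') (by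
          intro q hq
          obtain ⟨p, hp, rfl⟩ := Finset.mem_map.mp hq
          exact hx' p hp) hmem
      intro p hp
      exact h2 (p.1, p.2) (Finset.mem_map_of_mem _ hp)
    intro p hp
    rw [← hxv p hp]
    have : x p ∈ LinearMap.range ((fermionRep V).raise b) :=
      LinearMap.map_le_range (hmem' p hp)
    rwa [← ker_mk b hW hntriv] at this
  · simp only [drPiece]
    rw [← Submodule.map_iSup, iSup_fermionPiece, Submodule.map_top, LinearMap.range_eq_top]
    exact Ideal.Quotient.mk_surjective

instance (W : Subgroup (V ≃ₗ[ℂ] V)) (i j : ℕ) : FiniteDimensional ℂ (drPiece W i j) :=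
  inferInstanceAs (FiniteDimensional ℂ ((fermionPiece V i j).map
    (Ideal.Quotient.mkₐ ℂ (coinvariantIdeal W)).toLinearMap))

lemma finrank_drPiece_add (b : Basis ι ℂ V) {W : Subgroup (V ≃ₗ[ℂ] V)}
    (hW : IsIrreducibleReflectionGroup W) (hntriv : finrank ℂ V = 1 → W ≠ ⊥) (i j : ℕ) :
    finrank ℂ (drPiece W i j) + finrank ℂ (raiseImage b (i, j)) =
      finrank ℂ (fermionPiece V i j) := by
  rw [drPiece, ← finrank_map_add_finrank_inf_ker
    (Ideal.Quotient.mkₐ ℂ (coinvariantIdeal W)).toLinearMap (fermionPiece V i j),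
    ker_mk b hW hntriv, ← iSup_raiseImage, ← weight_natCast b,
    inf_iSup_eq_of_iSupIndep ((fermionRep V).weight_iSupIndep b) (raiseImage_le b)]

theorem finrank_drPiece_of_lt {W : Subgroup (V ≃ₗ[ℂ] V)}
    (hW : IsIrreducibleReflectionGroup W) (hntriv : finrank ℂ V = 1 → W ≠ ⊥) {i j : ℕ}
    (hij : finrank ℂ V < i + j) : finrank ℂ (drPiece W i j) = 0 := by
  have b := finBasis ℂ V
  have h := finrank_drPiece_add b hW hntriv i j
  have h1 : raiseImage b (i, j) = fermionPiece V i j := by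
    refine le_antisymm ((raiseImage_le b _).trans (weight_natCast b i j).le) fun x hx => ?_
    rw [← weight_natCast b] at hx
    refine (fermionRep V).mem_map_raise (fun p hp => weight_eq_bot_of_lt b (Or.inl ?_)) ?_ hx
    · simpa using hp
    · simp only [Fintype.card_fin]; exact_mod_cast hij
  rw [h1] at h
  omega

lemma finrank_raiseImage (b : Basis ι ℂ V) {p : ℤ × ℤ} (hp : p.1 + p.2 ≤ finrank ℂ V) :
    finrank ℂ (raiseImage b p) = finrank ℂ ((fermionRep V).weight b (p.1 - 1, p.2 - 1)) := by
  have h := finrank_map_add_finrank_inf_ker ((fermionRep V).raise b)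
    ((fermionRep V).weight b (p.1 - 1, p.2 - 1))
  have h0 : (fermionRep V).weight b (p.1 - 1, p.2 - 1) ⊓
      LinearMap.ker ((fermionRep V).raise b) = ⊥ := by
    rw [eq_bot_iff]
    rintro x ⟨hx, hx0⟩
    refine (fermionRep V).eq_zero_of_raise_eq_zero
      (fun q hq => weight_eq_bot_of_neg b (Or.inl hq)) ?_ hx hx0
    rw [← finrank_eq_card_basis b]
    simp only
    omega
  rw [h0, finrank_bot, add_zero] at h
  exact h

/-- Stated additively to avoid truncated subtraction; the `if` records that there is no source piece
for `raise` when a degree is zero. -/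
theorem finrank_drPiece_of_le {W : Subgroup (V ≃ₗ[ℂ] V)}
    (hW : IsIrreducibleReflectionGroup W) (hntriv : finrank ℂ V = 1 → W ≠ ⊥) {i j : ℕ}
    (hij : i + j ≤ finrank ℂ V) :
    finrank ℂ (drPiece W i j) + (if i = 0 ∨ j = 0 then 0 else
      (finrank ℂ V).choose (i - 1) * (finrank ℂ V).choose (j - 1)) =
        (finrank ℂ V).choose i * (finrank ℂ V).choose j := by
  have b := finBasis ℂ V
  rw [← finrank_fermionPiece i j, ← finrank_drPiece_add b hW hntriv i j,
    finrank_raiseImage b (by simp only; exact_mod_cast hij)]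
  congr 1
  split_ifs with h
  · rw [weight_eq_bot_of_neg b (by simp only; omega), finrank_bot]
  · push Not at h
    obtain ⟨i, rfl⟩ := Nat.exists_eq_succ_of_ne_zero h.1
    obtain ⟨j, rfl⟩ := Nat.exists_eq_succ_of_ne_zero h.2
    have : ((((i.succ : ℕ) : ℤ), ((j.succ : ℕ) : ℤ)).1 - 1,
        (((i.succ : ℕ) : ℤ), ((j.succ : ℕ) : ℤ)).2 - 1) = ((i : ℤ), (j : ℤ)) := by
      simp
    rw [this, weight_natCast, finrank_fermionPiece]
    rfl

end Coinvariants

/-! ### Counting paths -/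

/-- The contribution of a step to `deg_θ`. -/
def Step.thetaWeight : Step → ℕ
  | .up => 0
  | .down => 1
  | .theta => 1
  | .xi => 0

/-- The contribution of a step to `deg_ξ`. -/
def Step.xiWeight : Step → ℕ
  | .up => 0
  | .down => 1
  | .theta => 0
  | .xi => 1

lemma Step.vec_snd (s : Step) : s.vec.2 = 1 - s.thetaWeight - s.xiWeight := by
  cases s <;> rfl

lemma sum_step {M : Type*} [AddCommMonoid M] (g : Step → M) :
    ∑ s, g s = g .up + (g .down + (g .theta + g .xi)) := by
  have : (Finset.univ : Finset Step) = {Step.up, Step.down, Step.theta, Step.xi} := rfl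
  rw [this, Finset.sum_insert (by decide), Finset.sum_insert (by decide),
    Finset.sum_insert (by decide), Finset.sum_singleton]

namespace LatticePath

variable {n : ℕ}

lemma degTheta_eq_sum (σ : LatticePath n) : σ.degTheta = ∑ i, (σ i).thetaWeight := by
  rw [degTheta, Finset.card_filter, Finset.card_filter, ← Finset.sum_add_distrib]
  exact Finset.sum_congr rfl fun i _ => by cases σ i <;> rfl

lemma degXi_eq_sum (σ : LatticePath n) : σ.degXi = ∑ i, (σ i).xiWeight := by
  rw [degXi, Finset.card_filter, Finset.card_filter, ← Finset.sum_add_distrib]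
  exact Finset.sum_congr rfl fun i _ => by cases σ i <;> rfl

lemma point_self_snd (σ : LatticePath n) : (σ.point n).2 = n - σ.degTheta - σ.degXi := by
  rw [point, Finset.filter_true_of_mem fun i _ => i.2, Prod.snd_sum, degTheta_eq_sum,
    degXi_eq_sum]
  simp only [Step.vec_snd, Finset.sum_sub_distrib]
  simp

/-- Appending a step to a path. -/
abbrev append (τ : LatticePath n) (s : Step) : LatticePath (n + 1) :=
  Fin.snoc (α := fun _ => Step) τ s

lemma degTheta_append (τ : LatticePath n) (s : Step) :
    (τ.append s).degTheta = τ.degTheta + s.thetaWeight := by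
  simp [degTheta_eq_sum, Fin.sum_univ_castSucc]

lemma degXi_append (τ : LatticePath n) (s : Step) :
    (τ.append s).degXi = τ.degXi + s.xiWeight := by
  simp [degXi_eq_sum, Fin.sum_univ_castSucc]

lemma point_append (τ : LatticePath n) (s : Step) {k : ℕ} (hk : k ≤ n) :
    (τ.append s).point k = τ.point k := by
  simp [point, Finset.sum_filter, Fin.sum_univ_castSucc, hk.not_gt]

/-- The only new condition is on the final height, which is the length minus both degrees. -/
lemma neverBelow_append (τ : LatticePath n) (s : Step) :
    (τ.append s).NeverBelow ↔ τ.NeverBelow ∧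
      τ.degTheta + s.thetaWeight + (τ.degXi + s.xiWeight) ≤ n + 1 := by
  rw [NeverBelow, Fin.forall_fin_succ']
  refine and_congr (forall_congr' fun k => ?_) ?_
  · rw [Fin.val_castSucc, point_append τ s (Nat.le_of_lt_succ k.2)]
  · rw [Fin.val_last, point_self_snd, degTheta_append, degXi_append]
    push_cast
    omega

/-- The number of nonnegative paths with prescribed degrees. -/
def count (n : ℕ) (i j : ℤ) : ℤ :=
  ∑ σ : LatticePath n, if σ.NeverBelow ∧ (σ.degTheta : ℤ) = i ∧ (σ.degXi : ℤ) = j then 1 else 0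

/-- Paths are sorted by their last step. Integer indices make the four terms uniform, since negative
degrees count zero paths. -/
lemma count_succ (i j : ℤ) : count (n + 1) i j =
    if i + j ≤ n + 1 then
      count n i j + (count n (i - 1) (j - 1) + (count n (i - 1) j + count n i (j - 1))) else 0 := by
  have h1 : count (n + 1) i j = ∑ s : Step, ∑ τ : LatticePath n,
      if (τ.append s).NeverBelow ∧ ((τ.append s).degTheta : ℤ) = i ∧
        ((τ.append s).degXi : ℤ) = j then 1 else 0 := by
    rw [count, ← Fintype.sum_prod_type']
    exact (Fintype.sum_equiv (Fin.snocEquiv fun _ => Step) _ _ fun x => rfl).symm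
  have h2 : ∀ s : Step, (∑ τ : LatticePath n,
      if (τ.append s).NeverBelow ∧ ((τ.append s).degTheta : ℤ) = i ∧
        ((τ.append s).degXi : ℤ) = j then (1 : ℤ) else 0) =
      if i + j ≤ n + 1 then count n (i - s.thetaWeight) (j - s.xiWeight) else 0 := by
    intro s
    simp only [neverBelow_append, degTheta_append, degXi_append]
    split_ifs with h
    · refine Finset.sum_congr rfl fun τ _ => if_congr ?_ rfl rfl
      push_cast
      constructor
      · rintro ⟨⟨h1, -⟩, h2, h3⟩; exact ⟨h1, by omega, by omega⟩
      · rintro ⟨h1, h2, h3⟩; exact ⟨⟨h1, by omega⟩, by omega, by omega⟩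
    · refine Finset.sum_eq_zero fun τ _ => if_neg ?_
      push_cast
      rintro ⟨⟨-, h1⟩, h2, h3⟩
      omega
  rw [h1, sum_step, h2, h2, h2, h2]
  split_ifs <;> simp [Step.thetaWeight, Step.xiWeight]

end LatticePath

/-- Binomial coefficients extended by zero to negative lower indices. -/
def intChoose (n : ℕ) (i : ℤ) : ℤ := if i < 0 then 0 else n.choose i.toNat

lemma intChoose_natCast (n i : ℕ) : intChoose n i = n.choose i := by
  simp [intChoose]

lemma intChoose_sub_one_mul (n i j : ℕ) : intChoose n (i - 1) * intChoose n (j - 1) =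
    ((if i = 0 ∨ j = 0 then 0 else n.choose (i - 1) * n.choose (j - 1) : ℕ) : ℤ) := by
  split_ifs with h
  · rcases h with rfl | rfl <;> simp [intChoose]
  · rw [← Nat.cast_pred (by omega), ← Nat.cast_pred (by omega), intChoose_natCast,
      intChoose_natCast, Nat.cast_mul]

lemma intChoose_succ (n : ℕ) (i : ℤ) :
    intChoose (n + 1) i = intChoose n i + intChoose n (i - 1) := by
  rcases lt_trichotomy i 0 with h | rfl | h
  · simp [intChoose, h, show i - 1 < 0 by omega]
  · simp [intChoose]
  · obtain ⟨k, rfl⟩ : ∃ k : ℕ, i = (k + 1 : ℕ) := ⟨(i - 1).toNat, by omega⟩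
    rw [show ((k + 1 : ℕ) : ℤ) - 1 = (k : ℕ) by push_cast; ring, intChoose_natCast,
      intChoose_natCast, intChoose_natCast, Nat.choose_succ_succ]
    push_cast; ring

lemma intChoose_symm (n : ℕ) (i : ℤ) : intChoose n (n - i) = intChoose n i := by
  by_cases h0 : i < 0
  · rw [intChoose, intChoose, if_pos h0, if_neg (by omega), Nat.choose_eq_zero_of_lt (by omega),
      Nat.cast_zero]
  · by_cases hn : (n : ℤ) < i
    · rw [intChoose, intChoose, if_pos (by omega), if_neg h0, Nat.choose_eq_zero_of_lt (by omega),
        Nat.cast_zero]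
    · rw [intChoose, intChoose, if_neg (by omega), if_neg h0]
      rw [show ((n : ℤ) - i).toNat = n - i.toNat by omega, Nat.choose_symm (by omega)]

/-- The ballot-type formula for the number of nonnegative paths. -/
theorem LatticePath.count_eq (n : ℕ) : ∀ i j : ℤ, count n i j = if i + j ≤ n then
    intChoose n i * intChoose n j - intChoose n (i - 1) * intChoose n (j - 1) else 0 := by
  induction n with
  | zero =>
    intro i j
    have h1 : ∀ σ : LatticePath 0, σ.NeverBelow := fun σ k => by simp [point]
    have h2 : count 0 i j = if 0 = i ∧ 0 = j then 1 else 0 := by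
      rw [count, Fintype.sum_unique]
      simp [h1, degTheta, degXi]
    have h3 : ∀ k : ℤ, intChoose 0 k = if k = 0 then 1 else 0 := fun k => by
      rcases lt_trichotomy k 0 with h | rfl | h
      · simp [intChoose, h, h.ne]
      · simp [intChoose]
      · rw [intChoose, if_neg (by omega), Nat.choose_eq_zero_of_lt (by omega), if_neg (by omega),
          Nat.cast_zero]
    rw [h2, h3, h3, h3, h3]
    push_cast
    split_ifs <;> omega
  | succ n ih =>
    intro i j
    rw [count_succ]
    push_cast
    by_cases h : i + j ≤ n + 1
    · have h0 : count n i j =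
          intChoose n i * intChoose n j - intChoose n (i - 1) * intChoose n (j - 1) := by
        rw [ih]
        split_ifs with h'
        · rfl
        · rw [show i - 1 = n - j by omega, show j - 1 = n - i by omega, intChoose_symm,
            intChoose_symm]
          ring
      rw [if_pos h, if_pos h, h0, ih, ih, ih, if_pos (by omega), if_pos (by omega),
        if_pos (by omega)]
      simp only [intChoose_succ]
      ring
    · rw [if_neg h, if_neg h]

lemma coeff_sum_nonnegPaths (n : ℕ) (m : Fin 2 →₀ ℕ) :
    ((MvPowerSeries.coeff m (∑ σ ∈ nonnegPaths n,
      (MvPowerSeries.X 0 : MvPowerSeries (Fin 2) ℕ) ^ σ.degTheta *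
        (MvPowerSeries.X 1 : MvPowerSeries (Fin 2) ℕ) ^ σ.degXi) : ℕ) : ℤ) =
      LatticePath.count n (m 0) (m 1) := by
  rw [map_sum, nonnegPaths, Finset.sum_filter, LatticePath.count, Nat.cast_sum]
  refine Finset.sum_congr rfl fun σ _ => ?_
  rw [ite_and]
  split_ifs with h1 h2 <;>
    simp only [MvPowerSeries.X_pow_eq, MvPowerSeries.monomial_mul_monomial,
      MvPowerSeries.coeff_monomial, Nat.cast_ite, Nat.cast_zero, mul_one, Nat.cast_one]
  · refine if_pos ?_
    ext k
    fin_cases k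
    · simpa using (by exact_mod_cast h2.1.symm : m 0 = σ.degTheta)
    · simpa using (by exact_mod_cast h2.2.symm : m 1 = σ.degXi)
  · refine if_neg fun h => h2 ?_
    rw [h]
    simp

end FermionicCoinvariants

end
theorem corollary5p4 {V : Type*} [AddCommGroup V] [Module ℂ V] [FiniteDimensional ℂ V]
    (W : Subgroup (V ≃ₗ[ℂ] V))
    (hW : FermionicCoinvariants.IsIrreducibleReflectionGroup W)
    (n : ℕ) (hn : Module.finrank ℂ V = n)
    (hnontriv : n = 1 → W ≠ ⊥) :
    DirectSum.IsInternal
        (fun p : ℕ × ℕ => FermionicCoinvariants.drPiece W p.1 p.2) ∧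
      (∀ i j : ℕ, FiniteDimensional ℂ (FermionicCoinvariants.drPiece W i j)) ∧
      FermionicCoinvariants.hilb (FermionicCoinvariants.drPiece W) =
        ∑ σ ∈ FermionicCoinvariants.nonnegPaths n,
          (MvPowerSeries.X 0 : MvPowerSeries (Fin 2) ℕ) ^ σ.degTheta *
            (MvPowerSeries.X 1 : MvPowerSeries (Fin 2) ℕ) ^ σ.degXi := by
  subst hn
  refine ⟨FermionicCoinvariants.drPiece_isInternal hW hnontriv, fun i j => inferInstance, ?_⟩
  ext m
  rw [← Nat.cast_inj (R := ℤ), FermionicCoinvariants.coeff_sum_nonnegPaths,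
    FermionicCoinvariants.LatticePath.count_eq]
  change ((Module.finrank ℂ (FermionicCoinvariants.drPiece W (m 0) (m 1)) : ℕ) : ℤ) = _
  split_ifs with h
  · have h1 := FermionicCoinvariants.finrank_drPiece_of_le hW hnontriv
      (i := m 0) (j := m 1) (by exact_mod_cast h)
    rw [FermionicCoinvariants.intChoose_sub_one_mul, FermionicCoinvariants.intChoose_natCast,
      FermionicCoinvariants.intChoose_natCast, ← Nat.cast_mul, ← h1, Nat.cast_add,
      add_sub_cancel_right]
  · rw [FermionicCoinvariants.finrank_drPiece_of_lt hW hnontriv (by exact_mod_cast not_le.mp h),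
      Nat.cast_zero]
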